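/- **Setting.** Let $\mathcal H$ be an infinite-dimensional separable complex Hilbert space and $(\Omega,\mathcal A,P)$ a probability space. All processes are indexed by $t\in\mathbb Z$ and live on $(\Omega,\mathcal A,P)$; equalities between random variables hold almost surely. Let $\mathcal K$ stand for $\mathcal H$ or $\mathbb C$, and let $L$ be the lag operator and $\Delta=1-L$. A $\mathcal K$-valued process $\{\varepsilon_t\}$ is *white noise* if $0<E\|\varepsilon_t\|^2<\infty$, $E\varepsilon_t=0$, its covariance operator does not depend on $t$, and $\varepsilon_t,\varepsilon_s$ have zero cross-covariance for $s\ne t$. A $\mathcal K$-valued process $u_t$ is a *linear process* if $u_t-E u_t=\sum_{n\ge0}B_n\varepsilon_{t-n}$ for some $\mathcal K$-valued white noise $\varepsilon$ and bounded operators $B_n$ on $\mathcal K$ with $B_0=I$ and $B(z)=\sum_n B_nz^n$ absolutely convergent on $\{|z|<\rho\}$ for some $\rho>1$. It is *$I(0)$* if such a representation exists with $B(1)\neq0$; and $z_t$ is *$I(d)$*, $d\ge1$, if $\Delta^dz_t$ is $I(0)$. The *cointegrating space* of an $I(d)$ process $z_t$ in $\mathcal H$ is $\{v:\langle v,z_t\rangle\sim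 I(b)\text{ for some } b<d\}\cup\{0\}$, and its orthogonal complement is the *attractor space*. Let $A(z)=I-\sum_{h=1}^kA_h^\circ z^h$ with bounded operators $A_h^\circ$ on $\mathcal H$, and write $A(z)=\sum_{n\ge0}A_n(1-z)^n$. Assume that $A(L)x_t=\varepsilon_t$ is an *AR with a unit root of finite type*: $A(1)\ne0$; $A(1)$ is Fredholm (finite-dimensional kernel, closed image, finite-dimensional $(\operatorname{Im}A(1))^\perp$) with nonzero kernel; and for some $\rho>1$, $A(z)$ is invertible for all $|z|<\rho$, $z\neq1$. Here $\varepsilon$ is an $\mathcal H$-valued white noise whose covariance operator is injective, and $x_t$ is an $\mathcal H$-valued process with $E\|x_t\|^2<\infty$ that satisfies $A(L)x_t=\varepsilon_t$ for all $t\in\mathbb Z$ and for which $E\|x_t\|^2$ grows at most polynomially as $t\to-\infty$. Put $\zeta_0=\operatorname{Im}A_0$, $\tau_0=(\operatorname{Ker}A_0)^\perp$, $S_1=P_{\zeta_0^\perp}A_1P_{\tau_0^\perp}$ and $\tau_1=(\operatorname{Ker}S_1)^\perp$, where $P_\eta$ is the orthogonal projection on $\eta$. **Theorem (Characterization of $I(1)$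 ARs).** $x_t$ is $I(1)$ if and only if $$\mathcal H=\tau_0\oplus\tau_1 \ \text{(orthogonal direct sum)},\qquad \tau_1\ne\{0\}.$$ In this case: 1. There are bounded operators $C_n$, $n\ge0$, with $A(z)^{-1}=\sum_{n\ge0}C_n(1-z)^{n-1}$ in a punctured disc around $z=1$, and $x_t$ has the common trends representation $$x_t=C_0s_t+y_t+v_0,\qquad t\in\mathbb Z,$$ where $s_t=\sum_{i=1}^t\varepsilon_i$ for $t\ge1$, $s_0=0$, $s_t=-\sum_{i=t+1}^0\varepsilon_i$ for $t\le-1$; $y_t=\sum_{n\ge0}C^\star_n\varepsilon_{t-n}$, where $C^\star(z)=\sum_nC^\star_nz^n=A(z)^{-1}-(1-z)^{-1}C_0$ is absolutely convergent on $\{|z|<\rho'\}$ for some $\rho'>1$; and $v_0=x_0-y_0$, with $E x_t=E v_0$ for all $t$. 2. $\operatorname{Im}C_0=\tau_1=\tau_0^\perp\neq\{0\}$ is finite-dimensional and is the attractor space of $x_t$. 3. $\tau_0$ is infinite-dimensional and is the cointegrating space of $x_t$. 4. For every nonzero $v\in\mathcal H$: if $v\in\tau_0$ then $\langle v,x_t\rangle\sim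 I(0)$; if $v\in\tau_1$ then $\langle v,x_t\rangle\sim I(1)$. -/

import Mathlib

open MeasureTheory
open scoped InnerProductSpace

namespace HilbertAR

noncomputable section

section Processes

variable {Ω : Type*} [MeasurableSpace Ω]
variable {K : Type*} [NormedAddCommGroup K] [InnerProductSpace ℂ K] [CompleteSpace K]
  [MeasurableSpace K] [BorelSpace K]

/-- The (Hermitian) cross-covariance function
`(v, w) ↦ E (⟨v, Z - E Z⟩ * conj ⟨w, U - E U⟩)` of two `K`-valued random variables;
note that `⟪U - E U, w⟫` is the conjugate of `⟪w, U - E U⟫`. -/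
def crossCov (P : Measure Ω) (Z U : Ω → K) (v w : K) : ℂ :=
  ∫ ω, inner ℂ v (Z ω - ∫ ω', Z ω' ∂P) * inner ℂ (U ω - ∫ ω', U ω' ∂P) w ∂P

/-- Weakly stationary `K`-valued processes. -/
structure IsWeaklyStationary (P : Measure Ω) (ε : ℤ → Ω → K) : Prop where
  measurable : ∀ t, Measurable (ε t)
  memLp : ∀ t, MemLp (ε t) 2 P
  pos : ∀ t, 0 < ∫ ω, ‖ε t ω‖ ^ 2 ∂P
  mean_const : ∀ s t, ∫ ω, ε s ω ∂P = ∫ ω, ε t ω ∂P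
  cov_const : ∀ s t v w, crossCov P (ε s) (ε s) v w = crossCov P (ε t) (ε t) v w
  crossCov_shift : ∀ s t u v w,
    crossCov P (ε t) (ε s) v w = crossCov P (ε (t + u)) (ε (s + u)) v w

/-- White noise. -/
structure IsWhiteNoise (P : Measure Ω) (ε : ℤ → Ω → K) : Prop
    extends IsWeaklyStationary P ε where
  mean_zero : ∀ t, ∫ ω, ε t ω ∂P = 0
  uncorrelated : ∀ s t, s ≠ t → ∀ v w, crossCov P (ε t) (ε s) v w = 0

/-- The power series `∑ B n z ^ n` is absolutely convergent on the open disc `D(0, ρ)`. -/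
def AbsConvOnDisc (B : ℕ → K →L[ℂ] K) (ρ : ℝ) : Prop :=
  ∀ z : ℂ, ‖z‖ < ρ → Summable fun n => ‖B n‖ * ‖z‖ ^ n

/-- `u t = ∑ B n (ε (t - n))` almost surely, for every `t`. -/
def IsFilterOf (P : Measure Ω) (B : ℕ → K →L[ℂ] K) (ε u : ℤ → Ω → K) : Prop :=
  ∀ t : ℤ, ∀ᵐ ω ∂P, HasSum (fun n : ℕ => B n (ε (t - n) ω)) (u t ω)

/-- `u` is a linear process, `u t - E (u t) = ∑ B n (ε (t - n))`, with white noise `ε` and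
coefficients `B`, `B 0 = I`. -/
structure IsLinearProcess (P : Measure Ω) (ε : ℤ → Ω → K) (B : ℕ → K →L[ℂ] K)
    (u : ℤ → Ω → K) : Prop where
  measurable : ∀ t, Measurable (u t)
  integrable : ∀ t, Integrable (u t) P
  whiteNoise : IsWhiteNoise P ε
  zero_coeff : B 0 = ContinuousLinearMap.id ℂ K
  absConv : ∃ ρ : ℝ, 1 < ρ ∧ AbsConvOnDisc B ρ
  eq_filter : IsFilterOf P B ε (fun t ω => u t ω - ∫ ω', u t ω' ∂P)

/-- The process `u` is integrated of order `0`: it is a linear process with `B(1) ≠ 0`. -/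
def IsIntegratedZero (P : Measure Ω) (u : ℤ → Ω → K) : Prop :=
  ∃ (ε : ℤ → Ω → K) (B : ℕ → K →L[ℂ] K), IsLinearProcess P ε B u ∧ ∑' n, B n ≠ 0

/-- The difference operator `Δ = 1 - L`. -/
def diff (z : ℤ → Ω → K) : ℤ → Ω → K := fun t ω => z t ω - z (t - 1) ω

/-- The process `z` is integrated of order `d`: `Δ ^ d z` is integrated of order `0`. -/
def IsIntegrated (P : Measure Ω) (d : ℕ) (z : ℤ → Ω → K) : Prop :=
  IsIntegratedZero P (diff^[d] z)

/-- The cumulation operator: `∑_{i=1}^{t} w i` for `t ≥ 1`, `0` for `t = 0`, and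
`- ∑_{i=t+1}^{0} w i` for `t ≤ -1`. -/
def cumul (w : ℤ → Ω → K) : ℤ → Ω → K := fun t ω =>
  if 1 ≤ t then ∑ i ∈ Finset.Icc 1 t, w i ω
  else if t ≤ -1 then -∑ i ∈ Finset.Icc (t + 1) 0, w i ω
  else 0

/-- The `v`-characteristic `⟨v, x t⟩` of a process, a complex-valued process. -/
def characteristic (v : K) (x : ℤ → Ω → K) : ℤ → Ω → ℂ := fun t ω => inner ℂ v (x t ω)

/-- The cointegrating space of a process `z` that is integrated of order `d`. -/
def cointegratingSpace (P : Measure Ω) (d : ℕ) (z : ℤ → Ω → K) : Set K :=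
  {v | ∃ b < d, IsIntegrated P b (characteristic v z)} ∪ {0}

/-- The attractor space: the orthogonal complement of the cointegrating space. -/
def attractorSpace (P : Measure Ω) (d : ℕ) (z : ℤ → Ω → K) : Submodule ℂ K :=
  (Submodule.span ℂ (cointegratingSpace P d z))ᗮ

end Processes

section Operators

variable {H : Type*} [NormedAddCommGroup H] [InnerProductSpace ℂ H] [CompleteSpace H]

/-- The operator polynomial `A(z) = I - ∑_{h=1}^{k} a h z ^ h`. -/
def arPoly (k : ℕ) (a : ℕ → H →L[ℂ] H) (z : ℂ) : H →L[ℂ] H :=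
  ContinuousLinearMap.id ℂ H - ∑ h ∈ Finset.Icc 1 k, z ^ h • a h

/-- The coefficients `A n` of `A(z) = ∑ A n (1 - z) ^ n`. -/
def arCoeff (k : ℕ) (a : ℕ → H →L[ℂ] H) : ℕ → H →L[ℂ] H
  | 0 => ContinuousLinearMap.id ℂ H - ∑ h ∈ Finset.Icc 1 k, a h
  | n + 1 => (-1 : ℂ) ^ (n + 2) •
      ∑ j ∈ Finset.Icc (n + 1) k, ((j.choose (n + 1) : ℕ) : ℂ) • a j

/-- Fredholm operators: finite-dimensional kernel, closed image, and finite-dimensional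
orthogonal complement of the image. -/
structure IsFredholm (T : H →L[ℂ] H) : Prop where
  finite_ker : FiniteDimensional ℂ T.ker
  closed_range : IsClosed (T.range : Set H)
  finite_coker : FiniteDimensional ℂ (T.range)ᗮ

/-- `z₀` is an eigenvalue of finite type of the operator function `W`. -/
structure IsEigenvalueOfFiniteType (W : ℂ → H →L[ℂ] H) (z₀ : ℂ) : Prop where
  fredholm : IsFredholm (W z₀)
  exists_ker : ∃ v : H, v ≠ 0 ∧ W z₀ v = 0
  isolated : ∃ δ : ℝ, 0 < δ ∧ ∀ z : ℂ, ‖z - z₀‖ < δ → z ≠ z₀ → IsUnit (W z)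

/-- `A(z) = I - ∑_{h=1}^{k} a h z ^ h` is an AR with a unit root of finite type (at `z = 1`). -/
structure IsUnitRootOfFiniteType (k : ℕ) (a : ℕ → H →L[ℂ] H) : Prop where
  one_ne_zero : arPoly k a 1 ≠ 0
  finiteType : IsEigenvalueOfFiniteType (arPoly k a) 1
  invertible : ∃ ρ : ℝ, 1 < ρ ∧ ∀ z : ℂ, ‖z‖ < ρ → z ≠ 1 → IsUnit (arPoly k a z)

/-- `S₁ = P_{ζ₀ᗮ} A₁ P_{τ₀ᗮ}` with `ζ₀ = Im A₀` and `τ₀ = (Ker A₀)ᗮ`. -/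
def sOne (A₀ A₁ : H →L[ℂ] H) : H →L[ℂ] H :=
  (A₀.range)ᗮ.starProjection ∘L A₁ ∘L (A₀.kerᗮ)ᗮ.starProjection

/-- `τ₀ = (Ker A₀)ᗮ`. -/
def tauZero (k : ℕ) (a : ℕ → H →L[ℂ] H) : Submodule ℂ H :=
  (arCoeff k a 0).kerᗮ

/-- `τ₁ = (Ker S₁)ᗮ`. -/
def tauOne (k : ℕ) (a : ℕ → H →L[ℂ] H) : Submodule ℂ H :=
  (sOne (arCoeff k a 0) (arCoeff k a 1)).kerᗮ

/-- The orthogonal direct sum condition `H = τ₀ ⊕ τ₁`, `τ₁ ≠ 0`. -/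
structure PoleOneCondition (k : ℕ) (a : ℕ → H →L[ℂ] H) : Prop where
  isCompl : IsCompl (tauZero k a) (tauOne k a)
  isOrtho : tauZero k a ⟂ tauOne k a
  ne_bot : tauOne k a ≠ ⊥

/-- `A(z)⁻¹ = ∑ C n (1 - z) ^ (n - d)` in a punctured disc around `z = 1`. -/
def IsLaurentExpansionAtOne (A : ℂ → H →L[ℂ] H) (d : ℕ) (C : ℕ → H →L[ℂ] H) : Prop :=
  ∃ δ : ℝ, 0 < δ ∧ ∀ z : ℂ, ‖z - 1‖ < δ → z ≠ 1 → IsUnit (A z) ∧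
    HasSum (fun n : ℕ => (1 - z) ^ ((n : ℤ) - (d : ℤ)) • C n) (Ring.inverse (A z))

end Operators

section Solutions

variable {Ω : Type*} [MeasurableSpace Ω]
variable {H : Type*} [NormedAddCommGroup H] [InnerProductSpace ℂ H] [CompleteSpace H]
  [MeasurableSpace H] [BorelSpace H]

/-- `x` is a square integrable process that solves
`x t = a 1 (x (t - 1)) + ... + a k (x (t - k)) + ε t` for all `t ∈ ℤ`, and whose second moments
grow at most polynomially as `t → -∞`. -/
structure IsARSolution (P : Measure Ω) (k : ℕ) (a : ℕ → H →L[ℂ] H) (ε x : ℤ → Ω → H) :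
    Prop where
  measurable : ∀ t, Measurable (x t)
  memLp : ∀ t, MemLp (x t) 2 P
  eqn : ∀ t : ℤ, ∀ᵐ ω ∂P, x t ω = ∑ h ∈ Finset.Icc 1 k, a h (x (t - h) ω) + ε t ω
  growth : ∃ (M : ℝ) (m : ℕ), ∀ t : ℤ, t ≤ 0 →
    ∫ ω, ‖x t ω‖ ^ 2 ∂P ≤ M * (1 + |(t : ℝ)|) ^ m

/-- The common trends representation for a pole of order one,
`x t = C₀ s t + y t + v₀`, where `s` is the bilateral random walk cumulating `ε`,
`y = C⋆(L) ε` with `C⋆(z) = A(z)⁻¹ - (1 - z)⁻¹ C₀` absolutely convergent on a disc of radius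
larger than one, and `v₀` is the random vector `x 0 - y 0`; moreover `E (x t) = E v₀`. -/
def HasCommonTrendsOne (P : Measure Ω) (k : ℕ) (a : ℕ → H →L[ℂ] H) (C₀ : H →L[ℂ] H)
    (ε x : ℤ → Ω → H) : Prop :=
  ∃ (Cs : ℕ → H →L[ℂ] H) (y : ℤ → Ω → H) (v₀ : Ω → H),
    (∃ ρ : ℝ, 1 < ρ ∧ AbsConvOnDisc Cs ρ ∧ ∀ z : ℂ, ‖z‖ < ρ → z ≠ 1 →
      IsUnit (arPoly k a z) ∧
      HasSum (fun n : ℕ => z ^ n • Cs n) (Ring.inverse (arPoly k a z) - (1 - z)⁻¹ • C₀)) ∧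
    (∀ t, Measurable (y t)) ∧ IsFilterOf P Cs ε y ∧
    Measurable v₀ ∧ Integrable v₀ P ∧ (∀ᵐ ω ∂P, v₀ ω = x 0 ω - y 0 ω) ∧
    (∀ t, ∀ᵐ ω ∂P, x t ω = C₀ (cumul ε t ω) + y t ω + v₀ ω) ∧
    ∀ t, ∫ ω, x t ω ∂P = ∫ ω, v₀ ω ∂P

end Solutions

end

end HilbertAR

open HilbertAR

/-! Everything reduces to one condition: `S₁` is injective on `Ker A₀`. It is equivalent to the
decomposition `τ₀ ⊕ τ₁ = H` with `τ₁ ≠ 0`, because `S₁` vanishes on `τ₀` (`tauOne_eq_of_injOn`,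
`sOne_injOn_of_poleOneCondition`), and it is the condition for a simple pole of `A(z)⁻¹` at 1.

Sufficiency. Injectivity gives `|1 - z| ‖x‖ ≤ c ‖A(z) x‖` near 1 (`exists_lower_bound`), so `(1 - z)
A(z)⁻¹` is bounded there and extends analytically to some `E` on a disc of radius larger than one.
Its value `E 1` has range `Ker A₀`. Polynomial growth of `x` in the past against geometric decay of
coefficients permits filtering both sides of `A(L) x = ε`, and `E(z) A(z) = 1 - z` becomes `Δx =
E(L) ε`. Writing `E(z) = E 1 + (1 - z) S(z)` and summing the increments yields the common trends.

Necessity. If `S₁ v = 0` for some nonzero `v ∈ Ker A₀`, the compression of `A₁` from kernel to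
cokernel is not injective. As `A₀` is a limit of invertible operators, the kernel is no larger than
the cokernel (`finrank_ker_le_of_frequently_isUnit`), so the compression is not surjective either.
This produces functionals with `φ₀ A₀ = 0`, `φ₁ A₀ = -φ₀ A₁`, `φ₀ ≠ 0` (`exists_left_chain`). Then
`φ₀ ε` is the difference of a process built from finitely many values of `Δx` and `ε`
(`noise_eq_diff_of_left_chain`). If `x` were I(1), that process would be bounded in L², whereas the
random walk of a nondegenerate noise is not (`IsWhiteNoise.not_bounded_sum`).

Characteristics. For `v ∈ τ₀` the trend disappears and `⟨v, x⟩`, like `Δ⟨v, x⟩` for `v ∈ τ₁`, is a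
scalar filter of the `H`-valued noise with no zero on the unit circle. The definition of I(0) asks
for scalar noise. It comes from factoring the spectral density as `σ |β|²` with `β` analytic and
zero-free (`exists_spectral_factor`): dividing the filter by `β` whitens it. Conversely, an I(0)
characteristic is bounded in L², which forces `v ⟂ Im (E 1)`. -/

namespace HilbertAR

open Filter Topology

/-! ### Vector-valued power series on a disc. -/

section PowerSeries

variable {V : Type*} [NormedAddCommGroup V]

/-- The power series with coefficients `B` converges absolutely on the open disc of radius `ρ`. -/
def DiscSummable (B : ℕ → V) (ρ : ℝ) : Prop :=
  ∀ r : ℝ, 0 ≤ r → r < ρ → Summable fun n => ‖B n‖ * r ^ n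

theorem DiscSummable.summable_norm {B : ℕ → V} {ρ : ℝ} (h : DiscSummable B ρ) (hρ : 1 < ρ) :
    Summable fun n => ‖B n‖ := by simpa using h 1 zero_le_one hρ

theorem hasSum_sum_antidiagonal [CompleteSpace V] {f : ℕ × ℕ → V} {S : V} (h : HasSum f S) :
    HasSum (fun n => ∑ p ∈ Finset.HasAntidiagonal.antidiagonal n, f p) S := by
  have h1 := (Finset.HasAntidiagonal.sigmaAntidiagonalEquivProd (A := ℕ)).hasSum_iff.2 h
  refine h1.sigma (fun n => ?_)
  exact Finset.hasSum _ _

variable [NormedSpace ℂ V]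

/-- Convergence at a real point `R` between `r` and `ρ` bounds the terms there, and the ratio `(r /
R) ^ n` then supplies a geometric majorant. -/
theorem discSummable_of_hasSum {c : ℕ → V} {ρ : ℝ} {f : ℂ → V}
    (h : ∀ z : ℂ, ‖z‖ < ρ → HasSum (fun n => z ^ n • c n) (f z)) : DiscSummable c ρ := by
  intro r h0 hr
  obtain ⟨R, hrR, hR⟩ := exists_between hr
  have hRpos : 0 < R := h0.trans_lt hrR
  have hs := (h (R : ℂ) (by simpa [abs_of_pos hRpos] using hR)).summable
  obtain ⟨M, hM⟩ := (Metric.isBounded_range_of_tendsto _ hs.tendsto_atTop_zero).exists_norm_le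
  have hM' : ∀ n, ‖c n‖ * R ^ n ≤ M := fun n => by
    have := hM _ ⟨n, rfl⟩
    rw [norm_smul, norm_pow, Complex.norm_real, Real.norm_of_nonneg hRpos.le] at this
    linarith
  refine Summable.of_nonneg_of_le (fun n => by positivity) (fun n => ?_)
    ((summable_geometric_of_lt_one (div_nonneg h0 hRpos.le)
      ((div_lt_one hRpos).2 hrR)).mul_left M)
  calc ‖c n‖ * r ^ n = (‖c n‖ * R ^ n) * (r / R) ^ n := by
        rw [div_pow]; field_simp
    _ ≤ M * (r / R) ^ n := by gcongr; exact hM' n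

theorem exists_coeff [CompleteSpace V] {f : ℂ → V} {ρ : ℝ}
    (hf : DifferentiableOn ℂ f (Metric.ball 0 ρ)) :
    ∃ c : ℕ → V, DiscSummable c ρ ∧ ∀ z : ℂ, ‖z‖ < ρ → HasSum (fun n => z ^ n • c n) (f z) := by
  have key : ∀ z : ℂ, ‖z‖ < ρ →
      HasSum (fun n : ℕ => z ^ n • ((n.factorial : ℂ)⁻¹ • iteratedDeriv n f 0)) (f z) := by
    intro z hz
    have hρ : 0 < ρ := (norm_nonneg z).trans_lt hz
    have := Complex.hasSum_taylorSeries_on_ball (r := ρ) (c := 0) (f := f) hf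
      (z := z) (by simpa using hz)
    refine this.congr_fun fun n => ?_
    rw [sub_zero, smul_comm]
  exact ⟨_, discSummable_of_hasSum key, key⟩

/-- The formal power series with coefficients `c`. -/
noncomputable def coeffSeries (c : ℕ → V) : FormalMultilinearSeries ℂ ℂ V :=
  fun n => ContinuousMultilinearMap.mkPiRing ℂ (Fin n) (c n)

theorem hasFPowerSeriesAt_of_hasSum {c : ℕ → V} {f : ℂ → V} {ρ : ℝ} (hρ : 0 < ρ)
    (h : ∀ z : ℂ, ‖z‖ < ρ → HasSum (fun n => z ^ n • c n) (f z)) :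
    HasFPowerSeriesAt f (coeffSeries c) 0 := by
  rw [hasFPowerSeriesAt_iff]
  filter_upwards [Metric.ball_mem_nhds (0 : ℂ) hρ] with z hz
  simpa [coeffSeries, FormalMultilinearSeries.coeff] using h z (by simpa using hz)

/-- This converts identities between transfer functions, such as `E(z) A(z) = 1 - z`, into
identities between filter coefficients. -/
theorem coeff_unique {c c' : ℕ → V} {f : ℂ → V} {ρ : ℝ} (hρ : 0 < ρ)
    (h : ∀ z : ℂ, ‖z‖ < ρ → HasSum (fun n => z ^ n • c n) (f z))
    (h' : ∀ z : ℂ, ‖z‖ < ρ → HasSum (fun n => z ^ n • c' n) (f z)) : c = c' := by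
  have := (hasFPowerSeriesAt_of_hasSum hρ h).eq_formalMultilinearSeries
    (hasFPowerSeriesAt_of_hasSum hρ h')
  funext n
  have h2 := congrFun this n
  have h3 := congrArg (fun p => p (fun _ => (1 : ℂ))) h2
  simpa [coeffSeries] using h3

theorem differentiableOn_of_hasSum {c : ℕ → V} [CompleteSpace V] {f : ℂ → V} {ρ : ℝ}
    (h : ∀ z : ℂ, ‖z‖ < ρ → HasSum (fun n => z ^ n • c n) (f z)) :
    DifferentiableOn ℂ f (Metric.ball 0 ρ) := by
  rcases le_or_gt ρ 0 with hρ | hρ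
  · rw [Metric.ball_eq_empty.2 hρ]; exact differentiableOn_empty
  have hs := discSummable_of_hasSum h
  have : HasFPowerSeriesOnBall f (coeffSeries c) 0 (ENNReal.ofReal ρ) := by
    refine ⟨?_, by simpa using hρ, ?_⟩
    · refine ENNReal.le_of_forall_nnreal_lt fun r hr => ?_
      refine FormalMultilinearSeries.le_radius_of_summable _ ?_
      have hr' : (r : ℝ) < ρ := by
        rw [← ENNReal.ofReal_coe_nnreal, ENNReal.ofReal_lt_ofReal_iff hρ] at hr
        exact hr
      simpa [coeffSeries] using hs r r.2 hr'
    · intro y hy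
      have hy' : ‖y‖ < ρ := by
        rw [Metric.eball_ofReal] at hy
        simpa using hy
      simpa [coeffSeries] using h y hy'
  have := this.differentiableOn
  rwa [Metric.eball_ofReal] at this

end PowerSeries

/-! ### Composition of filters and Cauchy products. -/

section Filters

variable {E F G : Type*} [NormedAddCommGroup E] [NormedSpace ℂ E]
  [NormedAddCommGroup F] [NormedSpace ℂ F] [NormedAddCommGroup G] [NormedSpace ℂ G]

/-- The Cauchy product of two sequences of operators. -/
noncomputable def conv (B : ℕ → F →L[ℂ] G) (C : ℕ → E →L[ℂ] F) (N : ℕ) : E →L[ℂ] G :=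
  ∑ p ∈ Finset.HasAntidiagonal.antidiagonal N, B p.1 ∘L C p.2

theorem hasSum_conv [CompleteSpace G] {B : ℕ → F →L[ℂ] G} {C : ℕ → E →L[ℂ] F} {z : ℂ}
    {Bz : F →L[ℂ] G} {Cz : E →L[ℂ] F}
    (hB : Summable fun n => ‖B n‖ * ‖z‖ ^ n) (hC : Summable fun n => ‖C n‖ * ‖z‖ ^ n)
    (hBz : HasSum (fun n => z ^ n • B n) Bz) (hCz : HasSum (fun n => z ^ n • C n) Cz) :
    HasSum (fun n => z ^ n • conv B C n) (Bz ∘L Cz) := by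
  have hs : Summable fun p : ℕ × ℕ => (‖B p.1‖ * ‖z‖ ^ p.1) * (‖C p.2‖ * ‖z‖ ^ p.2) :=
    hB.mul_of_nonneg hC (fun _ => by positivity) (fun _ => by positivity)
  have hle : ∀ p : ℕ × ℕ, ‖(z ^ p.1 • B p.1) ∘L (z ^ p.2 • C p.2)‖ ≤
      (‖B p.1‖ * ‖z‖ ^ p.1) * (‖C p.2‖ * ‖z‖ ^ p.2) := fun p => by
    refine (ContinuousLinearMap.opNorm_comp_le _ _).trans_eq ?_
    simp only [norm_smul, norm_pow]; ring
  have hsn : Summable fun p : ℕ × ℕ => ‖(z ^ p.1 • B p.1) ∘L (z ^ p.2 • C p.2)‖ :=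
    Summable.of_nonneg_of_le (fun _ => norm_nonneg _) hle hs
  have h1 : HasSum (fun p : ℕ × ℕ => (z ^ p.1 • B p.1) ∘L (z ^ p.2 • C p.2)) (Bz ∘L Cz) := by
    have hsum := hsn.of_norm.hasSum
    have hfib : ∀ n : ℕ, HasSum (fun m => (z ^ n • B n) ∘L (z ^ m • C m)) ((z ^ n • B n) ∘L Cz) :=
      fun n => hCz.mapL (ContinuousLinearMap.compL ℂ E F G (z ^ n • B n))
    have h2 := hsum.prod_fiberwise hfib
    have h3 : HasSum (fun n => (z ^ n • B n) ∘L Cz) (Bz ∘L Cz) :=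
      hBz.mapL ((ContinuousLinearMap.compL ℂ E F G).flip Cz)
    rwa [h2.unique h3] at hsum
  have h4 := hasSum_sum_antidiagonal h1
  refine h4.congr_fun fun n => ?_
  simp only [conv, Finset.smul_sum]
  refine Finset.sum_congr rfl fun p hp => ?_
  rw [← Finset.HasAntidiagonal.mem_antidiagonal.1 hp, pow_add, ContinuousLinearMap.smul_comp,
    ContinuousLinearMap.comp_smul, smul_smul]

/-- Two filters in succession are the filter with the Cauchy product as coefficients. -/
theorem hasSum_filter_comp_iff [CompleteSpace G] {B : ℕ → F →L[ℂ] G} {C : ℕ → E →L[ℂ] F} {r : ℝ}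
    (h0 : 0 ≤ r)
    (hB : Summable fun n => ‖B n‖ * r ^ n) (hC : Summable fun n => ‖C n‖ * r ^ n)
    {w : ℤ → E} {v : ℤ → F} {t : ℤ} {M : ℝ} (hw : ∀ n : ℕ, ‖w (t - n)‖ ≤ M * r ^ n)
    (hv : ∀ n : ℕ, HasSum (fun m : ℕ => C m (w (t - n - m))) (v (t - n))) {S : G} :
    HasSum (fun n : ℕ => conv B C n (w (t - n))) S ↔ HasSum (fun n : ℕ => B n (v (t - n))) S := by
  have hs : Summable fun p : ℕ × ℕ => M * ((‖B p.1‖ * r ^ p.1) * (‖C p.2‖ * r ^ p.2)) :=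
    (hB.mul_of_nonneg hC (fun _ => by positivity) (fun _ => by positivity)).mul_left M
  have hsn : Summable fun p : ℕ × ℕ => ‖B p.1 (C p.2 (w (t - p.1 - p.2)))‖ := by
    refine Summable.of_nonneg_of_le (fun _ => norm_nonneg _) (fun p => ?_) hs
    have hw' := hw (p.1 + p.2)
    rw [Nat.cast_add, ← sub_sub] at hw'
    calc ‖B p.1 (C p.2 (w (t - p.1 - p.2)))‖
        ≤ ‖B p.1‖ * (‖C p.2‖ * ‖w (t - p.1 - p.2)‖) :=
          (ContinuousLinearMap.le_opNorm _ _).trans (by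
            gcongr; exact ContinuousLinearMap.le_opNorm _ _)
      _ ≤ ‖B p.1‖ * (‖C p.2‖ * (M * r ^ (p.1 + p.2))) := by gcongr
      _ = _ := by rw [pow_add]; ring
  have hsum := hsn.of_norm.hasSum
  -- One absolutely summable double series, summed by rows here and by antidiagonals in `h3`.
  have h2 := hsum.prod_fiberwise (fun n => (hv n).mapL (B n))
  have h3 := hasSum_sum_antidiagonal hsum
  have h4 : (fun n : ℕ => ∑ p ∈ Finset.HasAntidiagonal.antidiagonal n, B p.1 (C p.2 (w (t - p.1 - p.2)))) =
      fun n : ℕ => HilbertAR.conv B C n (w (t - n)) := by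
    funext n
    simp only [HilbertAR.conv, sum_apply, ContinuousLinearMap.comp_apply]
    refine Finset.sum_congr rfl fun p hp => ?_
    rw [← Finset.HasAntidiagonal.mem_antidiagonal.1 hp, Nat.cast_add, ← sub_sub]
  rw [h4] at h3
  constructor
  · intro h
    rwa [h.unique h3]
  · intro h
    rwa [h.unique h2]

end Filters


/-! ### Fredholm operators: index inequality, left chains, and the lower bound near a simple pole.
-/

section Fredholm

variable {H : Type*} [NormedAddCommGroup H] [InnerProductSpace ℂ H] [CompleteSpace H]

/-- By the open mapping theorem, closedness of the range gives a bounded inverse from `Im A` to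
`(Ker A)ᗮ`; it serves as a generalized inverse below. -/
theorem exists_equiv_range {A : H →L[ℂ] H} (hA : IsClosed (A.range : Set H)) :
    ∃ e : A.kerᗮ ≃L[ℂ] A.range, ∀ x, (e x : H) = A x := by
  have : CompleteSpace A.range := hA.completeSpace_coe
  have : CompleteSpace A.ker := A.isClosed_ker.completeSpace_coe
  let f : A.kerᗮ →L[ℂ] A.range :=
    (A ∘L A.kerᗮ.subtypeL).codRestrict A.range (fun x => ⟨_, rfl⟩)
  have hf : ∀ x, (f x : H) = A x := fun x => rfl
  have hinj : f.ker = ⊥ := by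
    rw [LinearMap.ker_eq_bot']
    intro x hx
    have h1 : A x = 0 := by rw [← hf]; exact congrArg Subtype.val hx
    have h2 : (x : H) ∈ A.ker := h1
    have h3 := Submodule.inner_right_of_mem_orthogonal h2 x.2
    exact Subtype.ext (inner_self_eq_zero.1 h3)
  have hsurj : f.range = ⊤ := by
    rw [LinearMap.range_eq_top]
    rintro ⟨_, u, rfl⟩
    refine ⟨⟨u - A.ker.starProjection u, Submodule.sub_starProjection_mem_orthogonal u⟩, ?_⟩
    refine Subtype.ext ?_
    change A (u - A.ker.starProjection u) = A u
    have : A (A.ker.starProjection u) = 0 := Submodule.starProjection_apply_mem A.ker u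
    rw [map_sub, this, sub_zero]
  exact ⟨ContinuousLinearEquiv.ofBijective f hinj hsurj, fun x => rfl⟩

/-- A Schur complement argument. For an invertible `T` close to `A`, the block of `T` from `(Ker
A)ᗮ` to `Im A` is still invertible, so eliminating it leaves a map from kernel to cokernel which
inherits injectivity from `T`. -/
theorem finrank_ker_le_of_frequently_isUnit {A : H →L[ℂ] H} (hA : IsFredholm A)
    (hu : ∀ δ > 0, ∃ T : H →L[ℂ] H, ‖T - A‖ < δ ∧ IsUnit T) :
    Module.finrank ℂ A.ker ≤ Module.finrank ℂ (A.range)ᗮ := by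
  have : CompleteSpace A.range := hA.closed_range.completeSpace_coe
  have := hA.finite_ker
  have := hA.finite_coker
  obtain ⟨e, he⟩ := exists_equiv_range hA.closed_range
  let Φ : (H →L[ℂ] H) → (A.kerᗮ →L[ℂ] A.range) := fun T =>
    A.range.orthogonalProjectionOnto ∘L T ∘L A.kerᗮ.subtypeL
  have hΦ : Continuous Φ := by fun_prop
  have hΦA : Φ A = e := by
    ext x
    simp only [Φ, ContinuousLinearMap.comp_apply, Submodule.subtypeL_apply]
    rw [← he]
    simp
  have hopen := ContinuousLinearEquiv.isOpen (𝕜 := ℂ) (E := A.kerᗮ) (F := A.range)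
  have hnhds := hΦ.continuousAt.preimage_mem_nhds (hopen.mem_nhds (x := Φ A) ⟨e, hΦA.symm⟩)
  obtain ⟨δ, hδ, hball⟩ := Metric.mem_nhds_iff.1 hnhds
  obtain ⟨T, hT, hTu⟩ := hu δ hδ
  obtain ⟨e', he'⟩ := hball (by simpa [dist_eq_norm] using hT : T ∈ Metric.ball A δ)
  have he'' : ∀ x, e' x = A.range.orthogonalProjectionOnto (T x) := fun x => by
    have := congrArg (fun f => f x) he'
    exact this
  -- The correction `r v` cancels the component of `T v` in `Im A`, so `T (v - r v)` lies in the
  -- cokernel.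
  let r : A.ker →ₗ[ℂ] A.kerᗮ := (e'.symm.toContinuousLinearMap ∘L A.range.orthogonalProjectionOnto ∘L
    T ∘L A.ker.subtypeL).toLinearMap
  have hr : ∀ v, A.range.orthogonalProjectionOnto (T (r v)) = A.range.orthogonalProjectionOnto (T v) := by
    intro v
    rw [← he'']
    exact e'.apply_symm_apply _
  let g : A.ker →ₗ[ℂ] (A.range)ᗮ :=
    (A.range)ᗮ.orthogonalProjectionOnto.toLinearMap ∘ₗ T.toLinearMap ∘ₗ
      (A.ker.subtype - A.kerᗮ.subtype ∘ₗ r)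
  refine LinearMap.finrank_le_finrank_of_injective (f := g) ?_
  rw [← LinearMap.ker_eq_bot, LinearMap.ker_eq_bot']
  intro v hv
  have h1 : (A.range)ᗮ.orthogonalProjectionOnto (T (v - r v)) = 0 := hv
  have h2 : A.range.orthogonalProjectionOnto (T (v - r v)) = 0 := by
    rw [map_sub, map_sub, hr, sub_self]
  have h3 : T (v - r v) = 0 := by
    have := A.range.starProjection_add_starProjection_orthogonal (T (v - r v))
    rw [Submodule.starProjection_apply, Submodule.starProjection_apply, h1, h2] at this
    simpa using this.symm
  have h4 : (v : H) - r v = 0 := by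
    obtain ⟨u, rfl⟩ := hTu
    have := congrArg (fun y => (↑u⁻¹ : H →L[ℂ] H) y) h3
    simpa [← mul_apply_eq_comp] using this
  have h5 : (v : H) ∈ A.kerᗮ := by
    rw [sub_eq_zero.1 h4]; exact (r v).2
  exact Subtype.ext (inner_self_eq_zero.1 (Submodule.inner_right_of_mem_orthogonal v.2 h5))

theorem sOne_apply_of_mem_ker {A₀ A₁ : H →L[ℂ] H} {v : H} (hv : v ∈ A₀.ker) :
    sOne A₀ A₁ v = (A₀.range)ᗮ.starProjection (A₁ v) := by
  have : CompleteSpace A₀.ker := A₀.isClosed_ker.completeSpace_coe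
  have h : (A₀.kerᗮ)ᗮ.starProjection v = v :=
    Submodule.starProjection_eq_self_iff.2 (A₀.ker.le_orthogonal_orthogonal hv)
  simp only [sOne, ContinuousLinearMap.comp_apply, h]

/-- By dimension count the compression of `A₁` to a map from kernel to cokernel misses some
direction `p`. Then `⟨p, A₁ ·⟩` vanishes on `Ker A₀` and therefore factors through `A₀`, which is
what defines `φ₁`. -/
theorem exists_left_chain {A₀ A₁ : H →L[ℂ] H} (hA : IsFredholm A₀)
    (hle : Module.finrank ℂ A₀.ker ≤ Module.finrank ℂ (A₀.range)ᗮ)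
    {v : H} (hv : v ∈ A₀.ker) (hv0 : v ≠ 0) (hS : sOne A₀ A₁ v = 0) :
    ∃ φ₀ φ₁ : H →L[ℂ] ℂ, φ₀ ≠ 0 ∧ (∀ x, φ₀ (A₀ x) = 0) ∧ ∀ x, φ₁ (A₀ x) = -φ₀ (A₁ x) := by
  have : CompleteSpace A₀.range := hA.closed_range.completeSpace_coe
  have : CompleteSpace A₀.ker := A₀.isClosed_ker.completeSpace_coe
  have := hA.finite_ker
  have := hA.finite_coker
  let L : A₀.ker →ₗ[ℂ] (A₀.range)ᗮ :=
    (A₀.range)ᗮ.orthogonalProjectionOnto.toLinearMap ∘ₗ A₁.toLinearMap ∘ₗ A₀.ker.subtype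
  have hLv : L ⟨v, hv⟩ = 0 := by
    rw [sOne_apply_of_mem_ker hv, Submodule.starProjection_apply] at hS
    exact Subtype.ext hS
  have hker : 0 < Module.finrank ℂ L.ker := by
    rw [Module.finrank_pos_iff_exists_ne_zero]
    exact ⟨⟨⟨v, hv⟩, hLv⟩, fun h => hv0 (congrArg (fun y : L.ker => ((y : A₀.ker) : H)) h)⟩
  have hrn := L.finrank_range_add_finrank_ker
  have hne : L.range ≠ ⊤ := by
    intro h
    rw [h, finrank_top] at hrn
    omega
  have hne' : L.rangeᗮ ≠ ⊥ := fun h => hne (Submodule.orthogonal_eq_bot_iff.1 h)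
  obtain ⟨p, hp, hp0⟩ := Submodule.exists_mem_ne_zero_of_ne_bot hne'
  obtain ⟨e, he⟩ := exists_equiv_range hA.closed_range
  have hφker : ∀ u ∈ A₀.ker, ⟪(p : H), A₁ u⟫_ℂ = 0 := by
    intro u hu
    have h1 : ⟪L ⟨u, hu⟩, p⟫_ℂ = 0 := hp _ ⟨_, rfl⟩
    have h2 := Submodule.inner_orthogonalProjectionOnto_eq_of_mem_left p (A₁ u)
    rw [← h2, ← inner_conj_symm]
    rw [show (A₀.range)ᗮ.orthogonalProjectionOnto (A₁ u) = L ⟨u, hu⟩ from rfl, h1, map_zero]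
  let φ₀ : H →L[ℂ] ℂ := innerSL ℂ (p : H)
  refine ⟨φ₀, -(φ₀ ∘L A₁ ∘L A₀.kerᗮ.subtypeL ∘L e.symm.toContinuousLinearMap ∘L
    A₀.range.orthogonalProjectionOnto), ?_, ?_, ?_⟩
  · intro h
    have : ⟪(p : H), p⟫_ℂ = 0 := congrArg (fun f => f (p : H)) h
    exact hp0 (Subtype.ext (inner_self_eq_zero.1 this))
  · intro x
    exact (Submodule.mem_orthogonal' _ _).1 p.2 _ ⟨x, rfl⟩
  · intro x
    let x₀ : A₀.kerᗮ := ⟨x - A₀.ker.starProjection x, Submodule.sub_starProjection_mem_orthogonal x⟩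
    have hx₀ : A₀ x₀ = A₀ x := by
      have : A₀ (A₀.ker.starProjection x) = 0 := Submodule.starProjection_apply_mem A₀.ker x
      simp only [x₀, map_sub, this, sub_zero]
    have h1 : A₀.range.orthogonalProjectionOnto (A₀ x) = e x₀ := by
      rw [← hx₀, ← he]; simp
    have h2 : ⟪(p : H), A₁ x₀⟫_ℂ = ⟪(p : H), A₁ x⟫_ℂ := by
      simp only [x₀, map_sub, inner_sub_right, hφker _ (Submodule.starProjection_apply_mem A₀.ker x),
        sub_zero]
    simp only [neg_apply, ContinuousLinearMap.comp_apply, h1,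
      ContinuousLinearEquiv.coe_coe, ContinuousLinearEquiv.symm_apply_apply,
      Submodule.subtypeL_apply]
    simp only [φ₀, innerSL_apply_apply, h2]

/-- The arithmetic of `exists_lower_bound`: `p` and `q` are the norms of the components off and in
the kernel, `y` is the norm of the image. Smallness of `s` lets the cross terms be absorbed with
factor 1/2, first for `p`, then for `s * q`. -/
theorem perturbation_bound {s p q y c₀ c₁ N : ℝ} (hs0 : 0 ≤ s) (hp0 : 0 ≤ p) (hq0 : 0 ≤ q)
    (hy0 : 0 ≤ y) (hc₀ : 0 ≤ c₀) (hc₁ : 0 ≤ c₁) (hN0 : 0 ≤ N) (hs1 : s ≤ 1)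
    (hi : p ≤ c₀ * (y + s * N * (p + q)))
    (hii : s * q ≤ c₁ * (y + s * N * p + s ^ 2 * N * (p + q)))
    (hsδ : s * (c₀ * N) ≤ 1 / 2) (hsδ' : s * (c₁ * (4 * c₀ * N ^ 2 + N)) ≤ 1 / 2) :
    s * (p + q) ≤ (2 * c₁ * (1 + 4 * c₀ * N)
      + 2 * c₀ * (1 + N * (2 * c₁ * (1 + 4 * c₀ * N)))) * y := by
  have hss : s ^ 2 ≤ s := by nlinarith
  have hp : p ≤ 2 * c₀ * (y + N * (s * q)) := by
    have : s * (c₀ * N) * p ≤ 1 / 2 * p := by gcongr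
    linarith
  have hq : s * q ≤ 2 * c₁ * (1 + 4 * c₀ * N) * y := by
    have h1 : s * q ≤ c₁ * (y + 2 * N * (s * p) + N * s * (s * q)) := by
      refine hii.trans (mul_le_mul_of_nonneg_left ?_ hc₁)
      have : s ^ 2 * (N * p) ≤ s * (N * p) := by gcongr
      linarith
    have h3 : s * q ≤ c₁ * (y + 2 * N * (s * (2 * c₀ * (y + N * (s * q)))) + N * s * (s * q)) :=
      h1.trans (by gcongr)
    have h3' : s * q ≤ c₁ * y + c₁ * (4 * c₀ * N * y) * s +
        s * (c₁ * (4 * c₀ * N ^ 2 + N)) * (s * q) := h3.trans_eq (by ring)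
    have h4 : s * (c₁ * (4 * c₀ * N ^ 2 + N)) * (s * q) ≤ 1 / 2 * (s * q) := by gcongr
    have h5 : c₁ * (4 * c₀ * N * y) * s ≤ c₁ * (4 * c₀ * N * y) * 1 := by gcongr
    linarith
  have hsp : s * p ≤ 1 * p := by gcongr
  have hp' : p ≤ 2 * c₀ * (y + N * (2 * c₁ * (1 + 4 * c₀ * N) * y)) := hp.trans (by gcongr)
  linarith

/-- `A₀` is bounded below on `(Ker A₀)ᗮ`, and the compression of `A₁` is bounded below on the
finite-dimensional kernel, where it enters with a factor `ζ`. The weaker of the two rates is the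
`‖ζ‖` in the bound. -/
theorem exists_lower_bound {A₀ A₁ : H →L[ℂ] H} (hA : IsFredholm A₀)
    (hS : ∀ v ∈ A₀.ker, sOne A₀ A₁ v = 0 → v = 0) {M : ℝ} (hM : 0 ≤ M) :
    ∃ c > 0, ∃ δ > 0, ∀ (ζ : ℂ) (T : H →L[ℂ] H), ‖ζ‖ < δ → ‖T - (A₀ + ζ • A₁)‖ ≤ M * ‖ζ‖ ^ 2 →
      ∀ x, ‖ζ‖ * ‖x‖ ≤ c * ‖T x‖ := by
  have : CompleteSpace A₀.range := hA.closed_range.completeSpace_coe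
  have : CompleteSpace A₀.ker := A₀.isClosed_ker.completeSpace_coe
  have := hA.finite_ker
  obtain ⟨e, he⟩ := exists_equiv_range hA.closed_range
  obtain ⟨c₀, hc₀, hbd₀⟩ : ∃ c₀ > 0, ∀ x ∈ A₀.kerᗮ, ‖x‖ ≤ c₀ * ‖A₀ x‖ := by
    refine ⟨‖e.symm.toContinuousLinearMap‖ + 1, by positivity, fun x hx => ?_⟩
    have h := e.symm.toContinuousLinearMap.le_opNorm (e ⟨x, hx⟩)
    have h2 : ‖e ⟨x, hx⟩‖ = ‖A₀ x‖ := by rw [← he ⟨x, hx⟩]; rfl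
    simp only [ContinuousLinearEquiv.coe_coe, ContinuousLinearEquiv.symm_apply_apply, h2] at h
    refine (show ‖x‖ ≤ _ from h).trans ?_
    gcongr; linarith
  obtain ⟨c₁, hc₁, hbd₁⟩ : ∃ c₁ > 0, ∀ x ∈ A₀.ker,
      ‖x‖ ≤ c₁ * ‖(A₀.range)ᗮ.starProjection (A₁ x)‖ := by
    let L : A₀.ker →ₗ[ℂ] H :=
      (A₀.range)ᗮ.starProjection.toLinearMap ∘ₗ A₁.toLinearMap ∘ₗ A₀.ker.subtype
    have hL : Function.Injective L := by
      rw [← LinearMap.ker_eq_bot, LinearMap.ker_eq_bot']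
      intro u hu
      refine Subtype.ext (hS u u.2 ?_)
      rw [sOne_apply_of_mem_ker u.2]; exact hu
    obtain ⟨K, hK, hK'⟩ := L.injective_iff_antilipschitz.1 hL
    refine ⟨K, hK, fun x hx => ?_⟩
    exact hK'.le_mul_norm (map_zero L) ⟨x, hx⟩
  set N : ℝ := ‖A₁‖ + M with hN
  have hN0 : 0 ≤ N := by positivity
  obtain ⟨δ, hδ, hδ1, hδ2, hδ3⟩ : ∃ δ > 0, δ ≤ 1 ∧ δ * (c₀ * N) ≤ 1 / 2 ∧
      δ * (c₁ * (4 * c₀ * N ^ 2 + N)) ≤ 1 / 2 := by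
    -- The denominator dominates 1 and twice each of the two products, so one `δ` meets all three
    -- requirements.
    refine ⟨1 / (1 + 2 * (c₀ * N) + 2 * (c₁ * (4 * c₀ * N ^ 2 + N))), by positivity, ?_, ?_, ?_⟩
    · rw [div_le_one (by positivity)]
      have : 0 ≤ c₀ * N := by positivity
      have : 0 ≤ c₁ * (4 * c₀ * N ^ 2 + N) := by positivity
      linarith
    · rw [div_mul_eq_mul_div, one_mul, div_le_iff₀ (by positivity)]
      have : 0 ≤ c₁ * (4 * c₀ * N ^ 2 + N) := by positivity
      linarith
    · rw [div_mul_eq_mul_div, one_mul, div_le_iff₀ (by positivity)]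
      have : 0 ≤ c₀ * N := by positivity
      linarith
  refine ⟨2 * c₁ * (1 + 4 * c₀ * N) + 2 * c₀ * (1 + N * (2 * c₁ * (1 + 4 * c₀ * N))),
    by positivity, δ, hδ, fun ζ T hζ hT x => ?_⟩
  set x₁ := A₀.ker.starProjection x
  set x₀ := x - x₁ with hx₀
  have hx₁ : x₁ ∈ A₀.ker := Submodule.starProjection_apply_mem A₀.ker x
  have hx₀' : x₀ ∈ A₀.kerᗮ := Submodule.sub_starProjection_mem_orthogonal x
  have hAx₁ : A₀ x₁ = 0 := hx₁
  have hAx : A₀ x = A₀ x₀ := by rw [hx₀, map_sub, hAx₁, sub_zero]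
  set s := ‖ζ‖
  set p := ‖x₀‖
  set q := ‖x₁‖
  set y := ‖T x‖
  have hs0 : 0 ≤ s := norm_nonneg _
  have hp0 : 0 ≤ p := norm_nonneg _
  have hq0 : 0 ≤ q := norm_nonneg _
  have hy0 : 0 ≤ y := norm_nonneg _
  have hxpq : ‖x‖ ≤ p + q := by
    have : x = x₀ + x₁ := by rw [hx₀]; abel
    rw [this]; exact norm_add_le _ _
  have hs1 : s ≤ 1 := hζ.le.trans hδ1
  set ρ := T x - (A₀ x + ζ • A₁ x) with hρ
  have hrem : ‖ρ‖ ≤ M * s ^ 2 * (p + q) := by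
    calc ‖ρ‖ = ‖(T - (A₀ + ζ • A₁)) x‖ := by simp [hρ]
      _ ≤ ‖T - (A₀ + ζ • A₁)‖ * ‖x‖ := ContinuousLinearMap.le_opNorm _ _
      _ ≤ M * s ^ 2 * (p + q) := by gcongr
  have hss : s ^ 2 ≤ s := by nlinarith
  have hi : p ≤ c₀ * (y + s * N * (p + q)) := by
    refine (hbd₀ x₀ hx₀').trans ?_
    gcongr
    rw [← hAx]
    have h1 : A₀ x = T x - ζ • A₁ x - ρ := by rw [hρ]; abel
    have h2 : ‖ζ • A₁ x‖ ≤ s * (‖A₁‖ * (p + q)) := by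
      rw [norm_smul]; gcongr
      exact (A₁.le_opNorm x).trans (by gcongr)
    calc ‖A₀ x‖ ≤ y + ‖ζ • A₁ x‖ + ‖ρ‖ := by
          rw [h1]; exact (norm_sub_le _ _).trans (by gcongr; exact norm_sub_le _ _)
      _ ≤ y + s * (‖A₁‖ * (p + q)) + M * s * (p + q) := by
          gcongr; exact hrem.trans (by gcongr)
      _ = _ := by rw [hN]; ring
  have hii : s * q ≤ c₁ * (y + s * N * p + s ^ 2 * N * (p + q)) := by
    have h0 := hbd₁ x₁ hx₁
    set Q := (A₀.range)ᗮ.starProjection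
    have hQ : ∀ u, ‖Q u‖ ≤ ‖u‖ := fun u => Submodule.norm_starProjection_apply_le _ u
    -- Projecting off `Im A₀` removes the term of order zero and leaves `ζ` times the compressed
    -- `A₁`.
    have hQA : Q (A₀ x) = 0 := by
      refine (Submodule.starProjection_apply_eq_zero_iff _).2 ?_
      exact A₀.range.le_orthogonal_orthogonal ⟨x, rfl⟩
    have h1 : ζ • Q (A₁ x₁) = Q (T x - ζ • A₁ x₀ - ρ) := by
      have : T x - ζ • A₁ x₀ - ρ = A₀ x + ζ • A₁ x₁ := by
        rw [hρ, hx₀, map_sub, smul_sub]; abel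
      rw [this, map_add, hQA, zero_add, map_smul]
    have h2 : s * ‖Q (A₁ x₁)‖ ≤ y + s * N * p + s ^ 2 * N * (p + q) := by
      have h3 : ‖ζ • A₁ x₀‖ ≤ s * (N * p) := by
        rw [norm_smul]; gcongr
        refine (A₁.le_opNorm x₀).trans ?_
        gcongr; linarith
      calc s * ‖Q (A₁ x₁)‖ = ‖ζ • Q (A₁ x₁)‖ := (norm_smul _ _).symm
        _ ≤ ‖T x - ζ • A₁ x₀ - ρ‖ := by rw [h1]; exact hQ _
        _ ≤ y + ‖ζ • A₁ x₀‖ + ‖ρ‖ :=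
          (norm_sub_le _ _).trans (by gcongr; exact norm_sub_le _ _)
        _ ≤ y + s * (N * p) + N * s ^ 2 * (p + q) := by
          gcongr; exact hrem.trans (by gcongr; linarith [norm_nonneg A₁])
        _ = _ := by ring
    calc s * q ≤ s * (c₁ * ‖Q (A₁ x₁)‖) := by gcongr
      _ = c₁ * (s * ‖Q (A₁ x₁)‖) := by ring
      _ ≤ _ := by gcongr
  have hsδ : s * (c₀ * N) ≤ 1 / 2 := le_trans (by gcongr) hδ2
  have hsδ' : s * (c₁ * (4 * c₀ * N ^ 2 + N)) ≤ 1 / 2 := le_trans (by gcongr) hδ3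
  calc s * ‖x‖ ≤ s * (p + q) := by gcongr
    _ ≤ _ := perturbation_bound hs0 hp0 hq0 hy0 hc₀.le hc₁.le hN0 hs1 hi hii hsδ hsδ'

end Fredholm


/-! ### The operator polynomial at its unit root and the regularized inverse. -/

section PoleOne

variable {H : Type*} [NormedAddCommGroup H] [InnerProductSpace ℂ H]
  {k : ℕ} {a : ℕ → H →L[ℂ] H}

theorem arCoeff_zero_eq (k : ℕ) (a : ℕ → H →L[ℂ] H) : arCoeff k a 0 = arPoly k a 1 := by
  simp [arCoeff, arPoly]

theorem arCoeff_one_eq (k : ℕ) (a : ℕ → H →L[ℂ] H) :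
    arCoeff k a 1 = ∑ h ∈ Finset.Icc 1 k, (h : ℂ) • a h := by
  simp [arCoeff]

theorem arPoly_zero (k : ℕ) (a : ℕ → H →L[ℂ] H) : arPoly k a 0 = ContinuousLinearMap.id ℂ H := by
  rw [arPoly, Finset.sum_eq_zero, sub_zero]
  intro h hh
  rw [zero_pow (by have := (Finset.mem_Icc.1 hh).1; omega), zero_smul]

theorem differentiable_arPoly (k : ℕ) (a : ℕ → H →L[ℂ] H) : Differentiable ℂ (arPoly k a) := by
  unfold arPoly
  fun_prop

theorem exists_norm_pow_sub_le (h : ℕ) : ∃ M : ℝ, 0 ≤ M ∧ ∀ z : ℂ, ‖1 - z‖ ≤ 1 →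
    ‖z ^ h - 1 + h * (1 - z)‖ ≤ M * ‖1 - z‖ ^ 2 := by
  induction h with
  | zero => exact ⟨0, le_rfl, fun z _ => by simp⟩
  | succ h ih =>
    obtain ⟨M, hM, ih⟩ := ih
    refine ⟨2 * M + h, by positivity, fun z hz => ?_⟩
    have hz2 : ‖z‖ ≤ 2 := by
      calc ‖z‖ = ‖1 - (1 - z)‖ := by congr 1; ring
        _ ≤ ‖(1 : ℂ)‖ + ‖1 - z‖ := norm_sub_le _ _
        _ ≤ 2 := by rw [norm_one]; linarith
    have : z ^ (h + 1) - 1 + ((h + 1 : ℕ) : ℂ) * (1 - z) =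
        z * (z ^ h - 1 + h * (1 - z)) + h * (1 - z) ^ 2 := by
      push_cast; ring
    rw [this]
    calc _ ≤ ‖z * (z ^ h - 1 + h * (1 - z))‖ + ‖(h : ℂ) * (1 - z) ^ 2‖ := norm_add_le _ _
      _ ≤ 2 * (M * ‖1 - z‖ ^ 2) + h * ‖1 - z‖ ^ 2 := by
        rw [norm_mul, norm_mul, norm_pow, Complex.norm_natCast]
        gcongr
        exact ih z hz
      _ = _ := by ring

theorem exists_norm_arPoly_sub_le (k : ℕ) (a : ℕ → H →L[ℂ] H) : ∃ M : ℝ, 0 ≤ M ∧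
    ∀ z : ℂ, ‖1 - z‖ ≤ 1 →
    ‖arPoly k a z - (arCoeff k a 0 + (1 - z) • arCoeff k a 1)‖ ≤ M * ‖1 - z‖ ^ 2 := by
  choose M hM hbd using exists_norm_pow_sub_le
  refine ⟨∑ h ∈ Finset.Icc 1 k, M h * ‖a h‖,
    Finset.sum_nonneg fun h _ => mul_nonneg (hM h) (norm_nonneg _), fun z hz => ?_⟩
  have : arPoly k a z - (arCoeff k a 0 + (1 - z) • arCoeff k a 1) =
      -∑ h ∈ Finset.Icc 1 k, (z ^ h - 1 + h * (1 - z)) • a h := by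
    rw [arCoeff_zero_eq, arCoeff_one_eq, arPoly, arPoly, Finset.smul_sum]
    simp only [add_smul, sub_smul, Finset.sum_add_distrib, Finset.sum_sub_distrib, one_pow,
      one_smul, smul_smul, mul_comm]
    abel
  rw [this, norm_neg, Finset.sum_mul]
  refine norm_sum_le_of_le _ fun h _ => ?_
  rw [norm_smul]
  calc _ ≤ (M h * ‖1 - z‖ ^ 2) * ‖a h‖ := by gcongr; exact hbd h z hz
    _ = _ := by ring

/-- The quotient by `1 - z` is exact and polynomial, so it is continuous at 1;
`range_regularized_one` evaluates it there. -/
theorem arPoly_eq_add (k : ℕ) (a : ℕ → H →L[ℂ] H) (z : ℂ) :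
    arPoly k a z = arCoeff k a 0 +
      (1 - z) • ∑ h ∈ Finset.Icc 1 k, (∑ i ∈ Finset.range h, z ^ i) • a h := by
  rw [arCoeff_zero_eq, arPoly, arPoly, Finset.smul_sum]
  simp only [smul_smul, mul_neg_geom_sum, sub_smul, Finset.sum_sub_distrib, one_pow, one_smul]
  abel

theorem isFredholm_arCoeff (hA : IsUnitRootOfFiniteType k a) : IsFredholm (arCoeff k a 0) := by
  rw [arCoeff_zero_eq]; exact hA.finiteType.fredholm

/-- The coefficients of the operator polynomial `A(z)` in powers of `z`. -/
noncomputable def arSeq (k : ℕ) (a : ℕ → H →L[ℂ] H) (n : ℕ) : H →L[ℂ] H :=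
  if n = 0 then ContinuousLinearMap.id ℂ H else if n ≤ k then -a n else 0

/-- The free maps `g n` cover both uses: powers of `z` for the transfer function, and evaluation at
lagged values for the filter. -/
theorem hasSum_arSeq_apply {V : Type*} [NormedAddCommGroup V] [NormedSpace ℂ V]
    (k : ℕ) (a : ℕ → H →L[ℂ] H) (g : ℕ → (H →L[ℂ] H) →L[ℂ] V) :
    HasSum (fun n => g n (arSeq k a n))
      (g 0 (ContinuousLinearMap.id ℂ H) - ∑ h ∈ Finset.Icc 1 k, g h (a h)) := by
  have h0 : ∀ n ∉ insert 0 (Finset.Icc 1 k), g n (arSeq k a n) = 0 := by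
    intro n hn
    simp only [Finset.mem_insert, Finset.mem_Icc, not_or, not_and, not_le] at hn
    rw [arSeq, if_neg hn.1, if_neg (by have := hn.2; omega), map_zero]
  have hs := hasSum_sum_of_ne_finset_zero (L := .unconditional ℕ) h0
  convert hs using 1
  rw [Finset.sum_insert (by simp), sub_eq_add_neg, ← Finset.sum_neg_distrib]
  congr 1
  refine Finset.sum_congr rfl fun n hn => ?_
  obtain ⟨h1, h2⟩ := Finset.mem_Icc.1 hn
  rw [arSeq, if_neg (by omega), if_pos h2, map_neg]

theorem hasSum_arSeq (k : ℕ) (a : ℕ → H →L[ℂ] H) (z : ℂ) :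
    HasSum (fun n => z ^ n • arSeq k a n) (arPoly k a z) := by
  have := hasSum_arSeq_apply k a (fun n => z ^ n • ContinuousLinearMap.id ℂ (H →L[ℂ] H))
  simpa [arPoly] using this

theorem discSummable_arSeq (k : ℕ) (a : ℕ → H →L[ℂ] H) (ρ : ℝ) :
    DiscSummable (arSeq k a) ρ :=
  discSummable_of_hasSum fun z _ => hasSum_arSeq k a z

variable [CompleteSpace H]

theorem exists_isUnit_near (hA : IsUnitRootOfFiniteType k a) :
    ∀ δ > 0, ∃ T : H →L[ℂ] H, ‖T - arCoeff k a 0‖ < δ ∧ IsUnit T := by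
  intro δ hδ
  obtain ⟨ρ, hρ, hu⟩ := hA.invertible
  have hc := (differentiable_arPoly k a).continuous.continuousAt (x := 1)
  obtain ⟨η, hη, hη'⟩ := Metric.continuousAt_iff.1 hc δ hδ
  -- Real points just left of 1 lie in the unit disc, where `A(z)` is invertible; the cap at 1 keeps
  -- the point nonnegative.
  refine ⟨arPoly k a ((1 - min (η / 2) 1 : ℝ) : ℂ), ?_, hu _ ?_ ?_⟩
  · rw [arCoeff_zero_eq, ← dist_eq_norm]
    apply hη'
    rw [Complex.dist_eq]
    have : ((1 - min (η / 2) 1 : ℝ) : ℂ) - 1 = ((-(min (η / 2) 1) : ℝ) : ℂ) := by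
      push_cast; ring
    rw [this, Complex.norm_real, norm_neg, Real.norm_of_nonneg (by positivity)]
    exact (min_le_left _ _).trans_lt (by linarith)
  · rw [Complex.norm_real, Real.norm_of_nonneg (by linarith [min_le_right (η / 2) 1])]
    have : 0 < min (η / 2) 1 := by positivity
    linarith
  · intro h
    have h2 := Complex.ofReal_eq_one.1 h
    have : 0 < min (η / 2) 1 := by positivity
    linarith

/-- A vector killed by both `A₀` and `S₁` is orthogonal to `τ₀` and to `τ₁`, hence to all of `H`. -/
theorem sOne_injOn_of_poleOneCondition (h : PoleOneCondition k a) :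
    ∀ v ∈ (arCoeff k a 0).ker, sOne (arCoeff k a 0) (arCoeff k a 1) v = 0 → v = 0 := by
  intro v hv hS
  have h1 : v ∈ (tauZero k a ⊔ tauOne k a)ᗮ := by
    rw [← Submodule.inf_orthogonal]
    exact ⟨Submodule.le_orthogonal_orthogonal _ hv, Submodule.le_orthogonal_orthogonal _ hS⟩
  rw [h.isCompl.sup_eq_top, Submodule.top_orthogonal_eq_bot] at h1
  simpa using h1

theorem tauZero_orthogonal (k : ℕ) (a : ℕ → H →L[ℂ] H) :
    (tauZero k a)ᗮ = (arCoeff k a 0).ker := by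
  have : CompleteSpace (arCoeff k a 0).ker := (arCoeff k a 0).isClosed_ker.completeSpace_coe
  exact Submodule.orthogonal_orthogonal _

/-- `S₁` factors through the projection on `Ker A₀`, so injectivity there makes its kernel exactly
`τ₀`. -/
theorem tauOne_eq_of_injOn
    (h : ∀ v ∈ (arCoeff k a 0).ker, sOne (arCoeff k a 0) (arCoeff k a 1) v = 0 → v = 0) :
    tauOne k a = (arCoeff k a 0).ker := by
  have hc : CompleteSpace (arCoeff k a 0).ker := (arCoeff k a 0).isClosed_ker.completeSpace_coe
  have hker : (sOne (arCoeff k a 0) (arCoeff k a 1)).ker = tauZero k a := by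
    set A := arCoeff k a 0
    have hproj : ∀ v, sOne A (arCoeff k a 1) (A.ker.starProjection v) =
        sOne A (arCoeff k a 1) v := fun v => by
      simp only [sOne, ContinuousLinearMap.comp_apply]
      rw [Submodule.starProjection_eq_self_iff.2
        (A.ker.le_orthogonal_orthogonal (Submodule.starProjection_apply_mem _ v))]
      simp only [Submodule.orthogonal_orthogonal]
    ext v
    constructor
    · intro hv
      have h0 : A.ker.starProjection v = 0 :=
        h _ (Submodule.starProjection_apply_mem _ v) ((hproj v).trans hv)
      exact (Submodule.starProjection_apply_eq_zero_iff _).1 h0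
    · intro hv
      have h0 : A.ker.starProjection v = 0 := (Submodule.starProjection_apply_eq_zero_iff _).2 hv
      change sOne A (arCoeff k a 1) v = 0
      rw [← hproj, h0, map_zero]
  rw [tauOne, hker, tauZero_orthogonal]

theorem poleOneCondition_of_injOn (hA : IsUnitRootOfFiniteType k a)
    (h : ∀ v ∈ (arCoeff k a 0).ker, sOne (arCoeff k a 0) (arCoeff k a 1) v = 0 → v = 0) :
    PoleOneCondition k a := by
  have hc : CompleteSpace (arCoeff k a 0).ker := (arCoeff k a 0).isClosed_ker.completeSpace_coe
  have h1 := tauOne_eq_of_injOn h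
  refine ⟨?_, ?_, ?_⟩
  · rw [h1, tauZero]
    exact (Submodule.isCompl_orthogonal (K := (arCoeff k a 0).ker)).symm
  · rw [h1, tauZero]
    exact (Submodule.isOrtho_orthogonal_right _).symm
  · rw [h1]
    obtain ⟨v, hv0, hv⟩ := hA.finiteType.exists_ker
    rw [← arCoeff_zero_eq] at hv
    intro hb
    exact hv0 ((Submodule.eq_bot_iff _).1 hb v hv)

/-- For a simple pole, `(1 - z) A(z)⁻¹` extends analytically to a disc of radius larger than one. -/
theorem exists_regularized_inverse (hA : IsUnitRootOfFiniteType k a)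
    (h : ∀ v ∈ (arCoeff k a 0).ker, sOne (arCoeff k a 0) (arCoeff k a 1) v = 0 → v = 0) :
    ∃ (ρ : ℝ) (E : ℂ → H →L[ℂ] H), 1 < ρ ∧ DifferentiableOn ℂ E (Metric.ball 0 ρ) ∧
      (∀ z, ‖z‖ < ρ → z ≠ 1 → IsUnit (arPoly k a z)) ∧
      (∀ z, z ≠ 1 → E z = (1 - z) • Ring.inverse (arPoly k a z)) := by
  obtain ⟨ρ, hρ, hu⟩ := hA.invertible
  obtain ⟨M, hM, hbd⟩ := exists_norm_arPoly_sub_le k a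
  obtain ⟨c, hc, δ, hδ, hlow⟩ := exists_lower_bound (isFredholm_arCoeff hA) h hM
  set f : ℂ → H →L[ℂ] H := fun z => (1 - z) • Ring.inverse (arPoly k a z) with hf
  have hfd : ∀ z, ‖z‖ < ρ → z ≠ 1 → DifferentiableAt ℂ f z := fun z hz hz1 =>
    ((differentiableAt_const (1 : ℂ)).sub differentiableAt_id).smul
      ((differentiable_arPoly k a z).inverse (hu z hz hz1))
  set δ' := min (min δ 1) (ρ - 1)
  have hδ' : 0 < δ' := by
    refine lt_min (lt_min hδ one_pos) (by linarith)
  have hball : ∀ z ∈ Metric.ball (1 : ℂ) δ', ‖z‖ < ρ ∧ ‖1 - z‖ < δ ∧ ‖1 - z‖ ≤ 1 := by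
    intro z hz
    rw [Metric.mem_ball, dist_comm, dist_eq_norm] at hz
    refine ⟨?_, hz.trans_le ((min_le_left _ _).trans (min_le_left _ _)),
      hz.le.trans ((min_le_left _ _).trans (min_le_right _ _))⟩
    calc ‖z‖ = ‖1 - (1 - z)‖ := by congr 1; ring
      _ ≤ ‖(1 : ℂ)‖ + ‖1 - z‖ := norm_sub_le _ _
      _ < 1 + (ρ - 1) := by rw [norm_one]; gcongr; exact hz.trans_le (min_le_right _ _)
      _ = ρ := by ring
  -- The lower bound, applied to `A(z)⁻¹ y`, bounds `(1 - z) A(z)⁻¹` by `c`, so the singularity is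
  -- removable.
  have hbdd : BddAbove (norm ∘ f '' (Metric.ball (1 : ℂ) δ' \ {1})) := by
    refine ⟨c, ?_⟩
    rintro _ ⟨z, ⟨hz, hz1⟩, rfl⟩
    obtain ⟨h1, h2, h3⟩ := hball z hz
    refine ContinuousLinearMap.opNorm_le_bound _ hc.le fun y => ?_
    have h4 := hlow (1 - z) (arPoly k a z) h2 (hbd z h3) (Ring.inverse (arPoly k a z) y)
    rw [← ContinuousLinearMap.comp_apply, ← ContinuousLinearMap.mul_def,
      Ring.mul_inverse_cancel _ (hu z h1 hz1)] at h4
    simpa [hf, norm_smul] using h4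
  refine ⟨ρ, Function.update f 1 (limUnder (𝓝[≠] 1) f), hρ, ?_, hu, fun z hz =>
    Function.update_of_ne hz _ _⟩
  have hnear := Complex.differentiableOn_update_limUnder_of_bddAbove
    (Metric.ball_mem_nhds (1 : ℂ) hδ')
    (fun z hz => (hfd z (hball z hz.1).1 hz.2).differentiableWithinAt) hbdd
  intro z hz
  by_cases hz1 : z = 1
  · subst hz1
    exact (hnear.differentiableAt (Metric.ball_mem_nhds _ hδ')).differentiableWithinAt
  · refine DifferentiableAt.differentiableWithinAt ?_
    refine (hfd z (by simpa using hz) hz1).congr_of_eventuallyEq ?_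
    filter_upwards [isOpen_ne.mem_nhds hz1] with w hw
    exact Function.update_of_ne hw _ _

variable {ρ : ℝ} {E : ℂ → H →L[ℂ] H}

theorem eq_of_eventuallyEq_punctured {V : Type*} [TopologicalSpace V] [T2Space V] {f g : ℂ → V}
    {z : ℂ} (hf : ContinuousAt f z) (hg : ContinuousAt g z) (h : f =ᶠ[𝓝[≠] z] g) : f z = g z :=
  tendsto_nhds_unique ((hf.tendsto.mono_left nhdsWithin_le_nhds).congr' h)
    (hg.tendsto.mono_left nhdsWithin_le_nhds)

theorem regularized_comp (hρ : 1 < ρ) (hE : DifferentiableOn ℂ E (Metric.ball 0 ρ))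
    (hu : ∀ z, ‖z‖ < ρ → z ≠ 1 → IsUnit (arPoly k a z))
    (hEA : ∀ z, z ≠ 1 → E z = (1 - z) • Ring.inverse (arPoly k a z)) {z : ℂ} (hz : ‖z‖ < ρ) :
    E z ∘L arPoly k a z = (1 - z) • ContinuousLinearMap.id ℂ H ∧
      arPoly k a z ∘L E z = (1 - z) • ContinuousLinearMap.id ℂ H := by
  have key : ∀ z, ‖z‖ < ρ → z ≠ 1 → E z ∘L arPoly k a z = (1 - z) • ContinuousLinearMap.id ℂ H ∧
      arPoly k a z ∘L E z = (1 - z) • ContinuousLinearMap.id ℂ H := by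
    intro z hz hz1
    rw [hEA z hz1, ContinuousLinearMap.smul_comp, ContinuousLinearMap.comp_smul]
    constructor
    · exact congrArg _ (Ring.inverse_mul_cancel _ (hu z hz hz1))
    · exact congrArg _ (Ring.mul_inverse_cancel _ (hu z hz hz1))
  by_cases hz1 : z = 1
  swap
  · exact key z hz hz1
  have hEc : ContinuousAt E z :=
    (hE.differentiableAt (Metric.isOpen_ball.mem_nhds (by simpa using hz))).continuousAt
  have hAc : ContinuousAt (arPoly k a) z := (differentiable_arPoly k a z).continuousAt
  have hev : ∀ᶠ w in 𝓝[≠] z, ‖w‖ < ρ ∧ w ≠ 1 := by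
    rw [hz1] at hz ⊢
    filter_upwards [self_mem_nhdsWithin, nhdsWithin_le_nhds
      (Metric.isOpen_ball.mem_nhds (show (1 : ℂ) ∈ Metric.ball 0 ρ by simpa using hρ))] with w h1 h2
    exact ⟨by simpa using h2, h1⟩
  have hid : ContinuousAt (fun w : ℂ => (1 - w) • ContinuousLinearMap.id ℂ H) z := by fun_prop
  exact ⟨eq_of_eventuallyEq_punctured (f := fun w => E w ∘L arPoly k a w) (hEc.clm_comp hAc) hid
    (hev.mono fun w hw => (key w hw.1 hw.2).1),
    eq_of_eventuallyEq_punctured (f := fun w => arPoly k a w ∘L E w) (hAc.clm_comp hEc) hid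
    (hev.mono fun w hw => (key w hw.1 hw.2).2)⟩

/-- One inclusion is `A(1) E(1) = 0`. For the other, `A(z) v = (1 - z) Q(z) v` when `v ∈ Ker A₀`,
hence `E(z) Q(z) v = v` off 1 and, by continuity, at 1. -/
theorem range_regularized_one (hρ : 1 < ρ) (hE : DifferentiableOn ℂ E (Metric.ball 0 ρ))
    (hu : ∀ z, ‖z‖ < ρ → z ≠ 1 → IsUnit (arPoly k a z))
    (hEA : ∀ z, z ≠ 1 → E z = (1 - z) • Ring.inverse (arPoly k a z)) :
    (E 1).range = (arCoeff k a 0).ker := by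
  have h1 : ‖(1 : ℂ)‖ < ρ := by simpa using hρ
  apply le_antisymm
  · rintro _ ⟨u, rfl⟩
    have := congrArg (fun T => T u) (regularized_comp hρ hE hu hEA h1).2
    rw [← arCoeff_zero_eq] at this
    simpa using this
  · intro v hv
    set Q : ℂ → H →L[ℂ] H := fun z =>
      ∑ h ∈ Finset.Icc 1 k, (∑ i ∈ Finset.range h, z ^ i) • a h with hQ
    have hQc : Continuous Q := by fun_prop
    have hEc : ContinuousAt E 1 :=
      (hE.differentiableAt (Metric.isOpen_ball.mem_nhds (by simpa using hρ))).continuousAt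
    refine ⟨Q 1 v, ?_⟩
    refine eq_of_eventuallyEq_punctured (f := fun z => E z (Q z v)) (g := fun _ => v)
      (hEc.clm_apply (hQc.continuousAt.clm_apply continuousAt_const)) continuousAt_const ?_
    filter_upwards [self_mem_nhdsWithin, nhdsWithin_le_nhds
      (Metric.isOpen_ball.mem_nhds (show (1 : ℂ) ∈ Metric.ball 0 ρ by simpa using hρ))] with z h1 h2
    have h3 := congrArg (fun T => T v) (regularized_comp hρ hE hu hEA (by simpa using h2)).1
    have hv' : arCoeff k a 0 v = 0 := hv
    simp only [ContinuousLinearMap.comp_apply, arPoly_eq_add k a z, add_apply, hv',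
      zero_add, smul_apply, map_smul, ContinuousLinearMap.id_apply] at h3
    exact smul_right_injective H (sub_ne_zero.2 (Ne.symm h1)) h3

end PoleOne


/-! ### Functionals of random vectors as elements of L². -/

section L2

variable {Ω : Type*} [MeasurableSpace Ω] {P : Measure Ω}
variable {K : Type*} [NormedAddCommGroup K] [InnerProductSpace ℂ K]

/-- The map sending a functional `ℓ` to the class of the random variable `ℓ ∘ Z`. -/
noncomputable def funLp {Z : Ω → K} (hZ : MemLp Z 2 P) : (K →L[ℂ] ℂ) →L[ℂ] Lp ℂ 2 P :=
  LinearMap.mkContinuous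
    { toFun := fun ℓ => ℓ.compLp (hZ.toLp Z)
      map_add' := fun ℓ m => ContinuousLinearMap.add_compLp ℓ m _
      map_smul' := fun c ℓ => ContinuousLinearMap.smul_compLp c ℓ _ }
    ‖hZ.toLp Z‖ fun ℓ => (ContinuousLinearMap.norm_compLp_le ℓ _).trans_eq (mul_comm _ _)

theorem coeFn_funLp {Z : Ω → K} (hZ : MemLp Z 2 P) (ℓ : K →L[ℂ] ℂ) :
    funLp hZ ℓ =ᵐ[P] fun ω => ℓ (Z ω) := by
  have h1 := ℓ.coeFn_compLp (hZ.toLp Z)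
  filter_upwards [h1, hZ.coeFn_toLp] with ω h1 h2
  rw [← h2, ← h1]; rfl

/-- The L² inner product is conjugate-linear in its first argument, which is why `U` and `w` come
first on the left. -/
theorem inner_funLp {Z U : Ω → K} (hZ : MemLp Z 2 P) (hU : MemLp U 2 P)
    (hZ0 : ∫ ω, Z ω ∂P = 0) (hU0 : ∫ ω, U ω ∂P = 0) (v w : K) :
    ⟪funLp hU (innerSL ℂ w), funLp hZ (innerSL ℂ v)⟫_ℂ = crossCov P Z U v w := by
  rw [L2.inner_def, crossCov]
  refine integral_congr_ae ?_
  filter_upwards [coeFn_funLp hZ (innerSL ℂ v), coeFn_funLp hU (innerSL ℂ w)] with ω h1 h2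
  rw [h1, h2, hZ0, hU0, sub_zero, sub_zero]
  simp [innerSL_apply_apply]

theorem exists_innerSL_eq [CompleteSpace K] (ℓ : K →L[ℂ] ℂ) : ∃ v : K, innerSL ℂ v = ℓ :=
  ⟨(InnerProductSpace.toDual ℂ K).symm ℓ, by
    ext x; simp [innerSL_apply_apply]⟩

end L2

/-! ### White noise and its scalar filters in L². -/

section WhiteNoise

variable {Ω : Type*} [MeasurableSpace Ω] {P : Measure Ω}
variable {K : Type*} [NormedAddCommGroup K] [InnerProductSpace ℂ K] [CompleteSpace K]
  [MeasurableSpace K] {ε : ℤ → Ω → K}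

/-- The class of `ℓ (ε t)` in `L²`. -/
noncomputable def IsWhiteNoise.fn (hε : IsWhiteNoise P ε) (t : ℤ) : (K →L[ℂ] ℂ) →L[ℂ] Lp ℂ 2 P :=
  funLp (hε.memLp t)

theorem IsWhiteNoise.inner_fn_of_ne (hε : IsWhiteNoise P ε) {s t : ℤ} (hst : s ≠ t)
    (m ℓ : K →L[ℂ] ℂ) : ⟪hε.fn s m, hε.fn t ℓ⟫_ℂ = 0 := by
  obtain ⟨v, rfl⟩ := exists_innerSL_eq ℓ
  obtain ⟨w, rfl⟩ := exists_innerSL_eq m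
  exact (inner_funLp _ _ (hε.mean_zero t) (hε.mean_zero s) v w).trans (hε.uncorrelated s t hst v w)

theorem IsWhiteNoise.inner_fn_self (hε : IsWhiteNoise P ε) (t : ℤ) (m ℓ : K →L[ℂ] ℂ) :
    ⟪hε.fn t m, hε.fn t ℓ⟫_ℂ = ⟪hε.fn 0 m, hε.fn 0 ℓ⟫_ℂ := by
  obtain ⟨v, rfl⟩ := exists_innerSL_eq ℓ
  obtain ⟨w, rfl⟩ := exists_innerSL_eq m
  unfold IsWhiteNoise.fn
  rw [inner_funLp _ _ (hε.mean_zero t) (hε.mean_zero t) v w,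
    inner_funLp _ _ (hε.mean_zero 0) (hε.mean_zero 0) v w, hε.cov_const t 0]

theorem IsWhiteNoise.norm_fn (hε : IsWhiteNoise P ε) (t : ℤ) (ℓ : K →L[ℂ] ℂ) :
    ‖hε.fn t ℓ‖ = ‖hε.fn 0 ℓ‖ := by
  rw [norm_eq_sqrt_re_inner (𝕜 := ℂ), hε.inner_fn_self, ← norm_eq_sqrt_re_inner]

theorem IsWhiteNoise.norm_fn_le (hε : IsWhiteNoise P ε) (t : ℤ) (ℓ : K →L[ℂ] ℂ) :
    ‖hε.fn t ℓ‖ ≤ ‖hε.fn 0‖ * ‖ℓ‖ := by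
  rw [hε.norm_fn]; exact (hε.fn 0).le_opNorm ℓ

theorem IsWhiteNoise.fn_zero_injective (hε : IsWhiteNoise P ε)
    (hnd : ∀ v : K, v ≠ 0 → crossCov P (ε 0) (ε 0) v v ≠ 0) {ℓ : K →L[ℂ] ℂ} (hℓ : ℓ ≠ 0) :
    hε.fn 0 ℓ ≠ 0 := by
  obtain ⟨v, rfl⟩ := exists_innerSL_eq ℓ
  intro h
  have h1 := inner_funLp (hε.memLp 0) (hε.memLp 0) (hε.mean_zero 0) (hε.mean_zero 0) v v
  rw [show funLp (hε.memLp 0) (innerSL ℂ v) = 0 from h, inner_zero_left] at h1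
  refine hnd v ?_ h1.symm
  rintro rfl
  exact hℓ (map_zero _)

/-- The class in `L²` of the filter `∑ ℓ n (ε (t - n))`. -/
noncomputable def IsWhiteNoise.filterLp (hε : IsWhiteNoise P ε) (ℓ : ℕ → K →L[ℂ] ℂ) (t : ℤ) :
    Lp ℂ 2 P := ∑' n : ℕ, hε.fn (t - n) (ℓ n)

variable {ℓ : ℕ → K →L[ℂ] ℂ}

theorem IsWhiteNoise.summable_norm_filterLp (hε : IsWhiteNoise P ε)
    (hℓ : Summable fun n => ‖ℓ n‖) (t : ℤ) : Summable fun n : ℕ => ‖hε.fn (t - n) (ℓ n)‖ :=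
  Summable.of_nonneg_of_le (fun _ => norm_nonneg _) (fun _ => hε.norm_fn_le _ _)
    (hℓ.mul_left ‖hε.fn 0‖)

theorem IsWhiteNoise.hasSum_filterLp (hε : IsWhiteNoise P ε)
    (hℓ : Summable fun n => ‖ℓ n‖) (t : ℤ) :
    HasSum (fun n : ℕ => hε.fn (t - n) (ℓ n)) (hε.filterLp ℓ t) :=
  (hε.summable_norm_filterLp hℓ t).of_norm.hasSum

theorem IsWhiteNoise.norm_filterLp_le (hε : IsWhiteNoise P ε)
    (hℓ : Summable fun n => ‖ℓ n‖) (t : ℤ) :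
    ‖hε.filterLp ℓ t‖ ≤ ‖hε.fn 0‖ * ∑' n, ‖ℓ n‖ := by
  rw [← tsum_mul_left]
  refine (norm_tsum_le_tsum_norm (hε.summable_norm_filterLp hℓ t)).trans ?_
  exact (hε.summable_norm_filterLp hℓ t).tsum_le_tsum (fun n => hε.norm_fn_le _ _)
    (hℓ.mul_left _)

theorem IsWhiteNoise.ae_hasSum_filterLp (hε : IsWhiteNoise P ε)
    (hℓ : Summable fun n => ‖ℓ n‖) (t : ℤ) :
    ∀ᵐ ω ∂P, HasSum (fun n : ℕ => ℓ n (ε (t - n) ω)) (hε.filterLp ℓ t ω) := by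
  have h1 : ∑' n : ℕ, ‖hε.fn (t - n) (ℓ n)‖ₑ ≠ ⊤ :=
    tsum_enorm_ne_top_iff_summable_norm.2 (hε.summable_norm_filterLp hℓ t)
  have h2 : ∀ᵐ ω ∂P, ∀ n : ℕ, hε.fn (t - n) (ℓ n) ω = ℓ n (ε (t - n) ω) :=
    ae_all_iff.2 fun n => coeFn_funLp _ _
  filter_upwards [Lp.hasSum_coeFn_tsum h1, h2] with ω h1 h2
  simp only [h2] at h1
  exact h1

theorem IsWhiteNoise.ae_eq_filterLp (hε : IsWhiteNoise P ε)
    (hℓ : Summable fun n => ‖ℓ n‖) {t : ℤ} {u : Ω → ℂ}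
    (hu : ∀ᵐ ω ∂P, HasSum (fun n : ℕ => ℓ n (ε (t - n) ω)) (u ω)) :
    u =ᵐ[P] hε.filterLp ℓ t := by
  filter_upwards [hu, hε.ae_hasSum_filterLp hℓ t] with ω h1 h2 using h1.unique h2

/-- By orthogonality at distinct times only the pairs with lags `n` and `n + h`, which refer to the
same noise variable, survive. -/
theorem IsWhiteNoise.hasSum_inner_filterLp (hε : IsWhiteNoise P ε)
    (hℓ : Summable fun n => ‖ℓ n‖) (t : ℤ) (h : ℕ) :
    HasSum (fun n : ℕ => ⟪hε.fn 0 (ℓ n), hε.fn 0 (ℓ (n + h))⟫_ℂ)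
      ⟪hε.filterLp ℓ t, hε.filterLp ℓ (t + h)⟫_ℂ := by
  have h1 : ∀ n : ℕ, ⟪hε.fn (t - n) (ℓ n), hε.filterLp ℓ (t + h)⟫_ℂ =
      ⟪hε.fn 0 (ℓ n), hε.fn 0 (ℓ (n + h))⟫_ℂ := by
    intro n
    have h2 := (hε.hasSum_filterLp hℓ (t + h)).mapL (innerSL ℂ (hε.fn (t - n) (ℓ n)))
    have h3 := hasSum_single (f := fun j : ℕ =>
      innerSL ℂ (hε.fn (t - n) (ℓ n)) (hε.fn (t + h - j) (ℓ j))) (n + h) (fun j hj => by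
        refine hε.inner_fn_of_ne ?_ _ _
        intro h4
        apply hj
        have : (j : ℤ) = n + h := by linarith
        exact_mod_cast this)
    have h4 := h2.unique h3
    rw [innerSL_apply_apply, innerSL_apply_apply] at h4
    rw [h4, ← hε.inner_fn_self (t - n),
      show t + h - ((n + h : ℕ) : ℤ) = t - n by push_cast; ring]
  have h2 := (hε.hasSum_filterLp hℓ t).map (innerSLFlip ℂ (hε.filterLp ℓ (t + h)))
    (innerSLFlip ℂ (hε.filterLp ℓ (t + h))).continuous
  simpa [Function.comp_def, h1, innerSLFlip_apply_apply] using h2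

theorem IsWhiteNoise.inner_filterLp_const (hε : IsWhiteNoise P ε)
    (hℓ : Summable fun n => ‖ℓ n‖) (f : Lp ℂ 2 P) {t : ℤ}
    (h : ∀ n : ℕ, ⟪f, hε.fn (t - n) (ℓ n)⟫_ℂ = 0) : ⟪f, hε.filterLp ℓ t⟫_ℂ = 0 := by
  have h2 := (hε.hasSum_filterLp hℓ t).mapL (innerSL ℂ f)
  simp only [innerSL_apply_apply, h] at h2
  exact h2.unique hasSum_zero

/-- The random walk driven by a nondegenerate characteristic of a white noise is unbounded
in `L²`. -/
theorem IsWhiteNoise.not_bounded_sum (hε : IsWhiteNoise P ε)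
    {φ : K →L[ℂ] ℂ} (hφ : hε.fn 0 φ ≠ 0) {w : ℤ → Lp ℂ 2 P} {M : ℝ} (hM : ∀ t, ‖w t‖ ≤ M)
    (h : ∀ t, hε.fn t φ = w t - w (t - 1)) : False := by
  have h2 : ∀ n : ℕ, ∑ i ∈ Finset.range n, hε.fn (i + 1) φ = w n - w 0 := by
    intro n
    induction n with
    | zero => simp
    | succ n ih =>
      rw [Finset.sum_range_succ, ih, h]
      push_cast
      rw [add_sub_cancel_right]; abel
  -- Pythagoras: the increments are orthogonal with equal norms, so the squared norm grows linearly.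
  have h3 : ∀ n : ℕ, ‖∑ i ∈ Finset.range n, hε.fn (i + 1) φ‖ ^ 2 = n * ‖hε.fn 0 φ‖ ^ 2 := by
    intro n
    induction n with
    | zero => simp
    | succ n ih =>
      rw [Finset.sum_range_succ, @norm_add_sq ℂ, ih, hε.norm_fn (n + 1), sum_inner,
        Finset.sum_eq_zero (fun i hi => hε.inner_fn_of_ne (by
          have := Finset.mem_range.1 hi; omega) _ _)]
      simp; ring
  have h4 : ∀ n : ℕ, n * ‖hε.fn 0 φ‖ ^ 2 ≤ (2 * M) ^ 2 := by
    intro n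
    rw [← h3, h2]
    gcongr
    exact (norm_sub_le _ _).trans (by linarith [hM n, hM 0])
  have hpos : 0 < ‖hε.fn 0 φ‖ ^ 2 := by positivity
  obtain ⟨n, hn⟩ := exists_nat_gt ((2 * M) ^ 2 / ‖hε.fn 0 φ‖ ^ 2)
  rw [div_lt_iff₀ hpos] at hn
  exact absurd (h4 n) (not_le.2 hn)

variable [IsProbabilityMeasure P]

theorem IsWhiteNoise.integral_apply (hε : IsWhiteNoise P ε) (t : ℤ) (φ : K →L[ℂ] ℂ) :
    ∫ ω, φ (ε t ω) ∂P = 0 := by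
  rw [φ.integral_comp_comm ((hε.memLp t).integrable one_le_two), hε.mean_zero, map_zero]

/-- The mean is the inner product with the constant 1, so it passes through the L²-convergent
series. -/
theorem IsWhiteNoise.integral_filterLp (hε : IsWhiteNoise P ε)
    (hℓ : Summable fun n => ‖ℓ n‖) (t : ℤ) : ∫ ω, hε.filterLp ℓ t ω ∂P = 0 := by
  have key : ∀ f : Lp ℂ 2 P, ⟪indicatorConstLp 2 MeasurableSet.univ (measure_ne_top P _) (1 : ℂ),
      f⟫_ℂ = ∫ ω, f ω ∂P := fun f => by
    rw [L2.inner_indicatorConstLp_one, setIntegral_univ]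
  rw [← key]
  refine hε.inner_filterLp_const hℓ _ fun n => ?_
  rw [key]
  exact (integral_congr_ae (coeFn_funLp _ _)).trans (hε.integral_apply _ _)

end WhiteNoise

/-! ### Recognizing scalar white noise by inner products. -/

section Scalar

variable {Ω : Type*} [MeasurableSpace Ω] {P : Measure Ω}

theorem isWhiteNoise_of_inner {N : ℤ → Lp ℂ 2 P} {σ : ℂ} (hσ : σ ≠ 0)
    (h0 : ∀ t, ∫ ω, N t ω ∂P = 0) (hself : ∀ t, ⟪N t, N t⟫_ℂ = σ)
    (hne : ∀ s t, s ≠ t → ⟪N s, N t⟫_ℂ = 0) :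
    IsWhiteNoise P (fun t => (N t : Ω → ℂ)) := by
  have hcov : ∀ s t v w, crossCov P (N s) (N t) v w =
      (starRingEnd ℂ v * w) * ⟪N t, N s⟫_ℂ := by
    intro s t v w
    rw [crossCov, h0, h0, L2.inner_def, ← integral_const_mul]
    congr 1
    funext ω
    simp only [sub_zero, RCLike.inner_apply]
    ring
  have hnorm : ∀ s t, ⟪N s, N t⟫_ℂ = if s = t then σ else 0 := by
    intro s t
    split_ifs with h
    · rw [h, hself]
    · exact hne s t h
  refine ⟨⟨fun t => (Lp.stronglyMeasurable _).measurable, fun t => Lp.memLp _, fun t => ?_,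
    fun s t => by rw [h0, h0], fun s t v w => ?_, fun s t u v w => ?_⟩, h0, fun s t hst v w => ?_⟩
  · have h1 : ‖N t‖ ^ 2 = ∫ ω, ‖N t ω‖ ^ 2 ∂P := by
      have h2 : ((‖N t‖ ^ 2 : ℝ) : ℂ) = ((∫ ω, ‖N t ω‖ ^ 2 ∂P : ℝ) : ℂ) := by
        rw [← integral_complex_ofReal]
        push_cast
        rw [← Complex.coe_algebraMap, ← inner_self_eq_norm_sq_to_K (𝕜 := ℂ), L2.inner_def]
        refine integral_congr_ae (ae_of_all _ fun ω => ?_)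
        exact inner_self_eq_norm_sq_to_K (𝕜 := ℂ) _
      exact_mod_cast h2
    rw [← h1]
    have : N t ≠ 0 := fun h => hσ (by rw [← hself t, h, inner_zero_left])
    positivity
  · rw [hcov, hcov, hself, hself]
  · rw [hcov, hcov, hnorm, hnorm]
    simp
  · rw [hcov, hne s t hst, mul_zero]

end Scalar


/-! ### Fourier analysis on the circle and spectral factorization. -/

section Spectral

variable {G : Type*} [NormedAddCommGroup G] [InnerProductSpace ℂ G]

theorem fact_two_pi_pos : Fact (0 < 2 * Real.pi) := ⟨Real.two_pi_pos⟩

attribute [local instance] fact_two_pi_pos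

theorem integral_fourier (k : ℤ) :
    ∫ x, fourier k x ∂(AddCircle.haarAddCircle (T := 2 * Real.pi)) = if k = 0 then 1 else 0 := by
  have h := congrFun (fourierCoeff_fourier (T := 2 * Real.pi) k) 0
  simp only [fourierCoeff, neg_zero, fourier_zero, one_smul] at h
  rw [h]
  by_cases hk : k = 0
  · simp [hk]
  · simp [hk, Ne.symm hk]

/-- The sum at lag `h` is a Fourier coefficient of `‖Q‖ ^ 2` on the circle, and a constant has only
the zeroth one. A flat spectrum thus means uncorrelated values. -/
theorem hasSum_inner_of_norm_const {p : ℕ → G} (hp : Summable fun n => ‖p n‖)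
    {Q : ℂ → G} (hQ : ∀ z : ℂ, ‖z‖ = 1 → HasSum (fun n => z ^ n • p n) (Q z)) {σ : ℝ}
    (hσ : ∀ z : ℂ, ‖z‖ = 1 → ‖Q z‖ ^ 2 = σ) (h : ℕ) :
    HasSum (fun n : ℕ => ⟪p n, p (n + h)⟫_ℂ) (if h = 0 then (σ : ℂ) else 0) := by
  set F : ℕ × ℕ → AddCircle (2 * Real.pi) → ℂ := fun q x =>
    ⟪p q.1, p q.2⟫_ℂ * fourier ((q.2 : ℤ) - q.1 - h) x with hF
  have hnorm : ∀ (k : ℤ) (x : AddCircle (2 * Real.pi)), ‖fourier k x‖ = 1 := fun k x => by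
    rw [fourier_apply]; exact Circle.norm_coe _
  have hsq : Summable fun q : ℕ × ℕ => ‖p q.1‖ * ‖p q.2‖ :=
    hp.mul_of_nonneg hp (fun _ => norm_nonneg _) (fun _ => norm_nonneg _)
  have hFn : ∀ q x, ‖F q x‖ = ‖⟪p q.1, p q.2⟫_ℂ‖ := fun q x => by
    simp only [hF]
    rw [norm_mul, hnorm, mul_one]
  have hin : Summable fun q : ℕ × ℕ => ‖⟪p q.1, p q.2⟫_ℂ‖ :=
    Summable.of_nonneg_of_le (fun _ => norm_nonneg _) (fun q => norm_inner_le_norm _ _) hsq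
  have hpt : ∀ x, HasSum (fun q => F q x) (σ * fourier (-(h : ℤ)) x) := by
    intro x
    set z : ℂ := ((AddCircle.toCircle x : Circle) : ℂ) with hz
    have hz1 : ‖z‖ = 1 := Circle.norm_coe _
    have hz0 : z ≠ 0 := fun h0 => by rw [h0, norm_zero] at hz1; exact zero_ne_one hz1
    have hfz : ∀ k : ℤ, fourier k x = z ^ k := fun k => by
      rw [fourier_apply, AddCircle.toCircle_zsmul, Circle.coe_zpow]
    have hconj : (starRingEnd ℂ) z = z⁻¹ := (Complex.inv_eq_conj hz1).symm
    have hFx : ∀ q, F q x = z ^ (-(h : ℤ)) * ⟪z ^ q.1 • p q.1, z ^ q.2 • p q.2⟫_ℂ := by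
      intro q
      simp only [hF, hfz]
      rw [inner_smul_left, inner_smul_right, map_pow, hconj, sub_eq_add_neg, sub_eq_add_neg,
        zpow_add₀ hz0, zpow_add₀ hz0, zpow_natCast, zpow_neg z (q.1 : ℤ), zpow_natCast, inv_pow]
      ring
    have hs : Summable fun q : ℕ × ℕ => ⟪z ^ q.1 • p q.1, z ^ q.2 • p q.2⟫_ℂ := by
      refine Summable.of_norm (Summable.of_nonneg_of_le (fun _ => norm_nonneg _) (fun q => ?_) hsq)
      refine (norm_inner_le_norm _ _).trans_eq ?_
      simp [norm_smul, hz1]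
    have h1 := hs.hasSum.prod_fiberwise (fun n =>
      (hQ z hz1).mapL (innerSL ℂ (z ^ n • p n)))
    have h2 := (hQ z hz1).map (innerSLFlip ℂ (Q z)) (innerSLFlip ℂ (Q z)).continuous
    have h3 := h1.unique h2
    rw [innerSLFlip_apply_apply, inner_self_eq_norm_sq_to_K] at h3
    have h4 := hs.hasSum.mul_left (z ^ (-(h : ℤ)))
    rw [h3] at h4
    simp only [hFx, hfz]
    have h5 : (σ : ℂ) * z ^ (-(h : ℤ)) = z ^ (-(h : ℤ)) * (‖Q z‖ : ℂ) ^ 2 := by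
      rw [mul_comm, ← hσ z hz1]
      push_cast
      rfl
    rw [h5]
    exact h4
  have hint : ∀ q, Integrable (F q) AddCircle.haarAddCircle := fun q =>
    ((map_continuous (fourier ((q.2 : ℤ) - q.1 - h))).integrable_of_hasCompactSupport
      (HasCompactSupport.of_compactSpace _)).const_mul _
  have hsumint := hasSum_integral_of_summable_integral_norm hint (by simpa [hFn] using hin)
  have hval : ∀ q : ℕ × ℕ, ∫ x, F q x ∂AddCircle.haarAddCircle =
      if q.2 = q.1 + h then ⟪p q.1, p q.2⟫_ℂ else 0 := by
    intro q
    simp only [hF]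
    rw [integral_const_mul, integral_fourier]
    by_cases hq : q.2 = q.1 + h
    · rw [if_pos hq, if_pos (by rw [hq]; push_cast; ring), mul_one]
    · rw [if_neg hq, if_neg (by omega), mul_zero]
  have htot : ∫ x, ∑' q, F q x ∂AddCircle.haarAddCircle = if h = 0 then (σ : ℂ) else 0 := by
    rw [integral_congr_ae (ae_of_all _ fun x => (hpt x).tsum_eq), integral_const_mul,
      integral_fourier]
    by_cases hh : h = 0 <;> simp [hh]
  simp only [hval, htot] at hsumint
  refine hsumint.prod_fiberwise fun n => ?_
  have := hasSum_ite_eq (n + h) ⟪p n, p (n + h)⟫_ℂ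
  refine this.congr_fun fun m => ?_
  by_cases hm : m = n + h
  · simp [hm]
  · simp [hm]

/-- The conjugation of `z` cancels the antilinearity of the inner product. On the circle `conj z =
z⁻¹`, which allows `‖g z‖ ^ 2` to be continued analytically to an annulus. -/
theorem exists_hermitian_extension [CompleteSpace G] {g : ℂ → G} {ρ : ℝ}
    (hg : DifferentiableOn ℂ g (Metric.ball 0 ρ)) :
    ∃ g' : ℂ → G →L[ℂ] ℂ, DifferentiableOn ℂ g' (Metric.ball 0 ρ) ∧
      ∀ z, ‖z‖ < ρ → g' z = innerSL ℂ (g (starRingEnd ℂ z)) := by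
  obtain ⟨c, -, hc⟩ := exists_coeff hg
  refine ⟨fun z => innerSL ℂ (g (starRingEnd ℂ z)), ?_, fun z _ => rfl⟩
  refine differentiableOn_of_hasSum (c := fun n => innerSL ℂ (c n)) fun z hz => ?_
  have h := (hc (starRingEnd ℂ z) (by simpa using hz)).map (innerSL ℂ) (innerSL ℂ).continuous
  refine h.congr_fun fun n => ?_
  simp only [Function.comp_apply, ContinuousLinearMap.map_smulₛₗ, map_pow, Complex.conj_conj]

/-- Shifting the contour from radius 1 to radius `R` gains the factor `R⁻¹ ^ n`. -/
theorem norm_fourierCoeff_le {φ : ℂ → ℂ} {R : ℝ} (hR : 1 < R)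
    (hφ : ∀ z : ℂ, 1 ≤ ‖z‖ → ‖z‖ ≤ R → DifferentiableAt ℂ φ z) :
    ∃ M : ℝ, ∀ n : ℕ, ‖fourierCoeff (fun x : AddCircle (2 * Real.pi) =>
      φ (AddCircle.toCircle x)) n‖ ≤ M * R⁻¹ ^ n := by
  have hR0 : 0 < R := by linarith
  obtain ⟨M, hM⟩ := (isCompact_sphere (0 : ℂ) R).exists_bound_of_continuousOn (f := φ)
    (fun z hz => by
      have : ‖z‖ = R := by simpa using hz
      exact (hφ z (by linarith) this.le).continuousAt.continuousWithinAt)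
  refine ⟨M, fun n => ?_⟩
  set ψ : ℂ → ℂ := fun z => (z ^ (n + 1))⁻¹ * φ z
  have hψ : ∀ z : ℂ, 1 ≤ ‖z‖ → ‖z‖ ≤ R → DifferentiableAt ℂ ψ z := fun z h1 h2 =>
    DifferentiableAt.mul (DifferentiableAt.inv (by fun_prop)
      (pow_ne_zero _ (norm_pos_iff.1 (by linarith)))) (hφ z h1 h2)
  have hshift : (∮ z in C(0, R), ψ z) = ∮ z in C(0, 1), ψ z := by
    refine Complex.circleIntegral_eq_of_differentiable_on_annulus_off_countable one_pos hR.le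
      Set.countable_empty ?_ ?_
    · rintro z ⟨h1, h2⟩
      simp only [Metric.mem_closedBall, dist_zero_right, Metric.mem_ball, not_lt] at h1 h2
      exact (hψ z h2 h1).continuousAt.continuousWithinAt
    · rintro z ⟨⟨h1, h2⟩, -⟩
      simp only [Metric.mem_closedBall, dist_zero_right, Metric.mem_ball, not_le] at h1 h2
      exact hψ z h2.le h1.le
  have hcoef : (2 * Real.pi * Complex.I) * fourierCoeff (fun x : AddCircle (2 * Real.pi) =>
      φ (AddCircle.toCircle x)) n = ∮ z in C(0, 1), ψ z := by
    rw [fourierCoeff_eq_intervalIntegral _ _ 0, circleIntegral, zero_add, Complex.real_smul]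
    push_cast
    rw [← mul_assoc, show (2 * (Real.pi : ℂ) * Complex.I) * (1 / (2 * Real.pi)) = Complex.I by
      have : (Real.pi : ℂ) ≠ 0 := by exact_mod_cast Real.pi_ne_zero
      field_simp, ← intervalIntegral.integral_const_mul]
    refine intervalIntegral.integral_congr fun θ _ => ?_
    have h1 : ((AddCircle.toCircle (θ : AddCircle (2 * Real.pi)) : Circle) : ℂ) =
        circleMap 0 1 θ := by
      rw [AddCircle.toCircle_apply_mk, div_self Real.two_pi_pos.ne', one_mul, Circle.coe_exp]
      simp [circleMap]
    have h2 : circleMap 0 1 θ ≠ 0 := by simp [circleMap]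
    simp only [fourier_apply, AddCircle.toCircle_zsmul, zpow_neg, zpow_natCast, Circle.coe_inv,
      Circle.coe_pow, h1, deriv_circleMap, smul_eq_mul, ψ]
    field_simp
    ring
  have hbound : ‖∮ z in C(0, R), ψ z‖ ≤ 2 * Real.pi * R * (R⁻¹ ^ (n + 1) * M) := by
    refine circleIntegral.norm_integral_le_of_norm_le_const hR0.le fun z hz => ?_
    have hzR : ‖z‖ = R := by simpa using hz
    simp only [ψ, norm_mul, norm_inv, norm_pow, hzR, inv_pow]
    gcongr
    exact hM z hz
  rw [hshift, ← hcoef, norm_mul] at hbound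
  have h3 : ‖2 * (Real.pi : ℂ) * Complex.I‖ = 2 * Real.pi := by
    simp [abs_of_pos Real.pi_pos]
  rw [h3, pow_succ] at hbound
  have h4 : 2 * Real.pi * R * (R⁻¹ ^ n * R⁻¹ * M) = 2 * Real.pi * (M * R⁻¹ ^ n) := by
    field_simp
  rw [h4] at hbound
  exact le_of_mul_le_mul_left hbound Real.two_pi_pos

/-- Spectral factorization of `‖g z‖ ^ 2` on the unit circle, for an analytic function `g` without
zeros there. -/
theorem exists_spectral_factor [CompleteSpace G] {g : ℂ → G} {ρ : ℝ} (hρ : 1 < ρ)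
    (hg : DifferentiableOn ℂ g (Metric.ball 0 ρ)) (hne : ∀ z, ‖z‖ = 1 → g z ≠ 0) :
    ∃ (R : ℝ) (β : ℂ → ℂ) (σ : ℝ), 1 < R ∧ 0 < σ ∧ DifferentiableOn ℂ β (Metric.ball 0 R) ∧
      β 0 = 1 ∧ (∀ z, β z ≠ 0) ∧ ∀ z, ‖z‖ = 1 → ‖g z‖ ^ 2 = σ * ‖β z‖ ^ 2 := by
  obtain ⟨g', hg', hgg'⟩ := exists_hermitian_extension hg
  set F : ℂ → ℂ := fun z => g' z⁻¹ (g z) with hF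
  have hFnorm : ∀ z : ℂ, ‖z‖ = 1 → F z = ((‖g z‖ ^ 2 : ℝ) : ℂ) := by
    intro z hz
    simp only [hF]
    rw [hgg' _ (by rw [norm_inv, hz]; simpa using hρ), map_inv₀, ← Complex.inv_eq_conj hz,
      inv_inv, innerSL_apply_apply, inner_self_eq_norm_sq_to_K]
    push_cast; rfl
  set U : Set ℂ := {z | ‖z‖ < ρ ∧ z ≠ 0 ∧ ‖z⁻¹‖ < ρ} with hU
  have hUo : IsOpen U := by
    have h0 : IsOpen {z : ℂ | z ≠ 0} := isOpen_ne
    have h1 : IsOpen ({z : ℂ | z ≠ 0} ∩ (fun z : ℂ => ‖z⁻¹‖) ⁻¹' Set.Iio ρ) :=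
      ContinuousOn.isOpen_inter_preimage (continuousOn_inv₀.norm) h0 isOpen_Iio
    exact (isOpen_lt continuous_norm continuous_const).inter h1
  have hFd : ∀ z ∈ U, DifferentiableAt ℂ F z := by
    rintro z ⟨h1, h2, h3⟩
    refine DifferentiableAt.clm_apply ?_ (hg.differentiableAt
      (Metric.isOpen_ball.mem_nhds (by simpa using h1)))
    exact (hg'.differentiableAt (Metric.isOpen_ball.mem_nhds (by simpa using h3))).comp z
      (differentiableAt_inv h2)
  set U' : Set ℂ := U ∩ F ⁻¹' Complex.slitPlane
  have hU'o : IsOpen U' := ContinuousOn.isOpen_inter_preimage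
    (fun z hz => (hFd z hz).continuousAt.continuousWithinAt) hUo Complex.isOpen_slitPlane
  have hsub : Metric.sphere (0 : ℂ) 1 ⊆ U' := by
    intro z hz
    have hz1 : ‖z‖ = 1 := by simpa using hz
    refine ⟨⟨by rw [hz1]; exact hρ, norm_pos_iff.1 (by rw [hz1]; exact one_pos),
      by rw [norm_inv, hz1]; simpa using hρ⟩, ?_⟩
    rw [Set.mem_preimage, hFnorm z hz1, Complex.ofReal_mem_slitPlane]
    have := hne z hz1
    positivity
  -- By compactness `F` stays in the slit plane on a whole annulus, so its principal logarithm is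
  -- analytic there.
  obtain ⟨δ, hδ, hthick⟩ := (isCompact_sphere (0 : ℂ) 1).exists_thickening_subset_open hU'o hsub
  set R := 1 + δ / 2
  have hR : 1 < R := by simp only [R]; linarith
  have hann : ∀ z : ℂ, 1 ≤ ‖z‖ → ‖z‖ ≤ R → z ∈ U' := by
    intro z h1 h2
    refine hthick (Metric.mem_thickening_iff.2 ⟨(‖z‖ : ℂ)⁻¹ * z, ?_, ?_⟩)
    · have : ‖z‖ ≠ 0 := by linarith
      simp [this]
    · have hz0 : (‖z‖ : ℂ) ≠ 0 := by
        have : ‖z‖ ≠ 0 := by linarith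
        exact_mod_cast this
      have h3 : z - (‖z‖ : ℂ)⁻¹ * z = ((‖z‖ - 1 : ℝ) : ℂ) * ((‖z‖ : ℂ)⁻¹ * z) := by
        push_cast; field_simp
      rw [dist_eq_norm, h3, norm_mul, norm_mul, norm_inv, Complex.norm_real, Complex.norm_real,
        norm_norm, inv_mul_cancel₀ (by linarith), mul_one, Real.norm_of_nonneg (by linarith)]
      simp only [R] at h2
      linarith
  set φ : ℂ → ℂ := fun z => Complex.log (F z) with hφdef
  have hφ : ∀ z : ℂ, 1 ≤ ‖z‖ → ‖z‖ ≤ R → DifferentiableAt ℂ φ z := fun z h1 h2 =>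
    (hFd z (hann z h1 h2).1).clog (hann z h1 h2).2
  have hφreal : ∀ z : ℂ, ‖z‖ = 1 → φ z = ((Real.log (‖g z‖ ^ 2) : ℝ) : ℂ) := fun z hz => by
    simp only [hφdef]
    rw [hFnorm z hz, Complex.ofReal_log (by positivity)]
  let f : C(AddCircle (2 * Real.pi), ℂ) :=
    ⟨fun x => φ (AddCircle.toCircle x), by
      rw [continuous_iff_continuousAt]
      intro x
      have h1 : ‖(AddCircle.toCircle x : ℂ)‖ = 1 := Circle.norm_coe _
      refine ContinuousAt.comp (f := fun x => (AddCircle.toCircle x : ℂ))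
        (hφ _ h1.ge (h1.le.trans hR.le)).continuousAt ?_
      exact (continuous_subtype_val.comp AddCircle.continuous_toCircle).continuousAt⟩
  set c : ℤ → ℂ := fourierCoeff f with hc
  obtain ⟨M, hM⟩ := norm_fourierCoeff_le hR hφ
  have hM' : ∀ n : ℕ, ‖c n‖ ≤ M * R⁻¹ ^ n := hM
  -- The logarithm is real on the circle, so negative frequencies mirror the positive ones and decay
  -- equally fast.
  have hcneg : ∀ n : ℤ, c (-n) = starRingEnd ℂ (c n) := by
    intro n
    simp only [hc, fourierCoeff]
    rw [← integral_conj]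
    refine integral_congr_ae (ae_of_all _ fun x => ?_)
    have h1 : f x = ((Real.log (‖g (AddCircle.toCircle x)‖ ^ 2) : ℝ) : ℂ) :=
      hφreal _ (Circle.norm_coe _)
    simp only [smul_eq_mul, map_mul, h1, Complex.conj_ofReal, fourier_neg, Complex.conj_conj]
  have hR0 : 0 < R := by linarith
  have hcs : Summable fun n : ℕ => ‖c n‖ :=
    Summable.of_nonneg_of_le (fun _ => norm_nonneg _) hM'
      ((summable_geometric_of_lt_one (by positivity) (inv_lt_one_of_one_lt₀ hR)).mul_left M)
  have hcsum : Summable c := by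
    refine Summable.of_nat_of_neg hcs.of_norm ?_
    refine Summable.of_norm ?_
    simpa [hcneg] using hcs
  set h₀ : ℂ → ℂ := fun z => ∑' n : ℕ, z ^ n • c n with hh₀
  have hdisc : ∀ z : ℂ, ‖z‖ < R → HasSum (fun n : ℕ => z ^ n • c n) (h₀ z) := by
    intro z hz
    refine Summable.hasSum (Summable.of_norm ?_)
    refine Summable.of_nonneg_of_le (fun _ => norm_nonneg _) (fun n => ?_)
      ((summable_geometric_of_lt_one (r := ‖z‖ / R) (by positivity)
        ((div_lt_one hR0).2 hz)).mul_left M)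
    rw [norm_smul, norm_pow, div_eq_mul_inv, mul_pow]
    calc ‖z‖ ^ n * ‖c n‖ ≤ ‖z‖ ^ n * (M * R⁻¹ ^ n) := by gcongr; exact hM' n
      _ = _ := by ring
  have hreal : ∀ z : ℂ, ‖z‖ = 1 →
      Real.log (‖g z‖ ^ 2) = 2 * (h₀ z).re - (c 0).re := by
    intro z hz
    obtain ⟨x, hx⟩ : ∃ x : AddCircle (2 * Real.pi), (AddCircle.toCircle x : ℂ) = z := by
      obtain ⟨θ, hθ⟩ := Circle.exp_surjective ⟨z, mem_sphere_zero_iff_norm.2 hz⟩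
      refine ⟨(θ : AddCircle (2 * Real.pi)), ?_⟩
      rw [AddCircle.toCircle_apply_mk, div_self Real.two_pi_pos.ne', one_mul, hθ]
    have h1 := (has_pointwise_sum_fourier_series_of_summable hcsum x).nat_add_neg
    have hfx : f x = ((Real.log (‖g z‖ ^ 2) : ℝ) : ℂ) := by
      rw [← hφreal z hz, ← hx]; rfl
    have h2 := (hdisc z (by rw [hz]; exact hR))
    have h3 := h2.add ((Complex.hasSum_conj').2 h2)
    have h4 : ∀ n : ℕ, fourierCoeff f (n : ℤ) • fourier (n : ℤ) x +
        fourierCoeff f (-(n : ℤ)) • fourier (-(n : ℤ)) x =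
        z ^ n • c n + starRingEnd ℂ (z ^ n • c n) := by
      intro n
      have h5 : fourier (n : ℤ) x = z ^ n := by
        rw [fourier_apply, AddCircle.toCircle_zsmul, Circle.coe_zpow, hx, zpow_natCast]
      have h6 : fourierCoeff f (-(n : ℤ)) = starRingEnd ℂ (c n) := hcneg n
      rw [h6, fourier_neg, h5]
      simp only [smul_eq_mul, map_mul]
      ring
    simp only [h4] at h1
    have h7 := h1.unique h3
    have h8 := congrArg Complex.re h7
    simp only [fourier_zero, smul_eq_mul, mul_one, hfx, Complex.add_re, Complex.ofReal_re,
      Complex.conj_re] at h8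
    have h9 : (fourierCoeff f 0).re = (c 0).re := rfl
    linarith
  -- With `h₀` the half of the Fourier series with nonnegative frequencies, `log ‖g‖² = c 0 + 2 Re
  -- (h₀ - c 0)` on the circle. The exponential gives a factor without zeros, and subtracting `c 0`
  -- normalizes it at the origin.
  refine ⟨R, fun z => Complex.exp (h₀ z - c 0), Real.exp (c 0).re, hR, Real.exp_pos _, ?_, ?_,
    fun z => Complex.exp_ne_zero _, ?_⟩
  · exact ((differentiableOn_of_hasSum hdisc).sub_const _).cexp
  · have h0 : h₀ 0 = c 0 := by
      have h1 := hdisc 0 (by simpa using hR0)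
      have h2 := hasSum_single (f := fun n : ℕ => (0 : ℂ) ^ n • c n) 0 (fun n hn => by simp [hn])
      simpa using h1.unique h2
    simp only [h0, sub_self, Complex.exp_zero]
  · intro z hz
    have hg0 : 0 < ‖g z‖ ^ 2 := by
      have := hne z hz
      positivity
    rw [Complex.norm_exp, ← Real.exp_log hg0, hreal z hz, ← Real.exp_nat_mul, ← Real.exp_add]
    congr 1
    simp only [Complex.sub_re]
    push_cast
    ring

end Spectral


/-! ### Processes growing subexponentially in the past. -/

section Tempered

variable {Ω : Type*} [MeasurableSpace Ω] {P : Measure Ω}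
variable {E F : Type*} [NormedAddCommGroup E] [NormedSpace ℂ E]
  [NormedAddCommGroup F] [NormedSpace ℂ F]

theorem tsum_eLpNorm_one_ne_top {F : Type*} [NormedAddCommGroup F] {f : ℕ → Ω → F} (hf : ∀ n, Integrable (f n) P)
    (hs : Summable fun n => ∫ ω, ‖f n ω‖ ∂P) : ∑' n, eLpNorm (f n) 1 P ≠ ⊤ := by
  have : ∀ n, eLpNorm (f n) 1 P = ENNReal.ofReal (∫ ω, ‖f n ω‖ ∂P) := fun n => by
    rw [eLpNorm_one_eq_lintegral_enorm, ofReal_integral_norm_eq_lintegral_enorm (hf n)]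
  simp only [this]
  exact hs.tsum_ofReal_ne_top

theorem exists_measurable_tsum [CompleteSpace F] [MeasurableSpace F] [BorelSpace F]
    {f : ℕ → Ω → F} (hf : ∀ n, Integrable (f n) P)
    (hs : Summable fun n => ∫ ω, ‖f n ω‖ ∂P) :
    ∃ y : Ω → F, Measurable y ∧ Integrable y P ∧ (∀ᵐ ω ∂P, HasSum (fun n => f n ω) (y ω)) ∧
      ∫ ω, y ω ∂P = ∑' n, ∫ ω, f n ω ∂P := by
  set g : ℕ → Lp F 1 P := fun n => (hf n).toL1 (f n)
  have hg : ∑' n, ‖g n‖ₑ ≠ ⊤ := by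
    have : ∀ n, ‖g n‖ₑ = eLpNorm (f n) 1 P := fun n => Lp.enorm_toLp _
    simpa only [this] using tsum_eLpNorm_one_ne_top hf hs
  have hfg : ∀ᵐ ω ∂P, ∀ n, g n ω = f n ω := ae_all_iff.2 fun n => (hf n).coeFn_toL1
  have hsum : ∀ᵐ ω ∂P, HasSum (fun n => f n ω) ((∑' n, g n : Lp F 1 P) ω) := by
    filter_upwards [hfg, Lp.hasSum_coeFn_tsum hg] with ω h1 h2
    simp only [h1] at h2
    exact h2
  refine ⟨(∑' n, g n : Lp F 1 P), (Lp.stronglyMeasurable _).measurable,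
    L1.integrable_coeFn _, hsum, ?_⟩
  rw [(hasSum_integral_of_summable_integral_norm hf hs).tsum_eq]
  refine integral_congr_ae ?_
  filter_upwards [hsum] with ω h using h.tsum_eq.symm

/-- The first absolute moments of `w` grow subexponentially as time goes to `-∞`. -/
def TemperedMean (P : Measure Ω) (w : ℤ → Ω → E) : Prop :=
  ∀ r : ℝ, 1 < r → ∀ t : ℤ, Summable fun n : ℕ => (∫ ω, ‖w (t - n) ω‖ ∂P) * r⁻¹ ^ n

/-- The discounted norms have a summable sequence of means, so they are almost surely summable,
hence bounded. -/
theorem TemperedMean.ae_norm_le {w : ℤ → Ω → E} (hw : TemperedMean P w)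
    (hint : ∀ t, Integrable (w t) P) {r : ℝ} (hr : 1 < r) :
    ∀ᵐ ω ∂P, ∀ t : ℤ, ∃ M : ℝ, ∀ n : ℕ, ‖w (t - n) ω‖ ≤ M * r ^ n := by
  refine ae_all_iff.2 fun t => ?_
  have hr0 : 0 < r := by linarith
  set f : ℕ → Ω → E := fun n ω => ((r⁻¹ ^ n : ℝ) : ℂ) • w (t - n) ω with hf
  have hfi : ∀ n, Integrable (f n) P := fun n => (hint _).smul _
  have hfn : ∀ n ω, ‖f n ω‖ = ‖w (t - n) ω‖ * r⁻¹ ^ n := fun n ω => by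
    simp only [hf]
    rw [norm_smul, Complex.norm_real, Real.norm_of_nonneg (by positivity), mul_comm]
  have hs : Summable fun n => ∫ ω, ‖f n ω‖ ∂P := by
    simpa only [hfn, integral_mul_const] using hw r hr t
  have := summable_norm_of_tsum_eLpNorm_ne_top le_rfl (fun n => (hfi n).aestronglyMeasurable)
    (tsum_eLpNorm_one_ne_top hfi hs)
  filter_upwards [this] with ω hω
  refine ⟨∑' n, ‖f n ω‖, fun n => ?_⟩
  have h1 := hω.le_tsum n fun _ _ => norm_nonneg _
  rw [hfn] at h1
  calc ‖w (t - n) ω‖ = ‖w (t - n) ω‖ * r⁻¹ ^ n * r ^ n := by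
        rw [mul_assoc, ← mul_pow, inv_mul_cancel₀ hr0.ne', one_pow, mul_one]
    _ ≤ _ := by gcongr

theorem TemperedMean.summable_filter {w : ℤ → Ω → E} (hw : TemperedMean P w)
    (hint : ∀ t, Integrable (w t) P) {B : ℕ → E →L[ℂ] F} {ρ : ℝ} (hρ : 1 < ρ)
    (hB : DiscSummable B ρ) (t : ℤ) :
    Summable fun n : ℕ => ∫ ω, ‖B n (w (t - n) ω)‖ ∂P := by
  obtain ⟨r, hr1, hr⟩ := exists_between hρ
  have hr0 : 0 < r := by linarith
  have h1 := hw r hr1 t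
  refine Summable.of_nonneg_of_le (fun n => integral_nonneg fun _ => norm_nonneg _) (fun n => ?_)
    ((hB r hr0.le hr).mul_right (∑' n : ℕ, (∫ ω, ‖w (t - n) ω‖ ∂P) * r⁻¹ ^ n))
  have h2 := h1.le_tsum n fun m _ =>
    mul_nonneg (integral_nonneg fun _ => norm_nonneg _) (by positivity)
  calc ∫ ω, ‖B n (w (t - n) ω)‖ ∂P ≤ ∫ ω, ‖B n‖ * ‖w (t - n) ω‖ ∂P :=
        integral_mono ((B n).integrable_comp (hint _)).norm ((hint _).norm.const_mul _)
          fun ω => (B n).le_opNorm _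
    _ = ‖B n‖ * r ^ n * ((∫ ω, ‖w (t - n) ω‖ ∂P) * r⁻¹ ^ n) := by
        rw [integral_const_mul, inv_pow]
        field_simp
    _ ≤ _ := by gcongr

theorem TemperedMean.exists_filter [CompleteSpace E] [CompleteSpace F] [MeasurableSpace F]
    [BorelSpace F]
    {w : ℤ → Ω → E} (hw : TemperedMean P w) (hint : ∀ t, Integrable (w t) P)
    (h0 : ∀ t, ∫ ω, w t ω ∂P = 0) {B : ℕ → E →L[ℂ] F} {ρ : ℝ} (hρ : 1 < ρ)
    (hB : DiscSummable B ρ) :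
    ∃ y : ℤ → Ω → F, (∀ t, Measurable (y t)) ∧ (∀ t, Integrable (y t) P) ∧
      (∀ t, ∫ ω, y t ω ∂P = 0) ∧
      ∀ t : ℤ, ∀ᵐ ω ∂P, HasSum (fun n : ℕ => B n (w (t - n) ω)) (y t ω) := by
  have key := fun t : ℤ => exists_measurable_tsum (P := P) (f := fun (n : ℕ) ω => B n (w (t - n) ω))
    (fun n => (B n).integrable_comp (hint _)) (hw.summable_filter hint hρ hB t)
  choose y h1 h2 h3 h4 using key
  refine ⟨y, h1, h2, fun t => ?_, h3⟩
  rw [h4]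
  have : ∀ n : ℕ, ∫ ω, B n (w (t - n) ω) ∂P = 0 := fun n => by
    rw [(B n).integral_comp_comm (hint _), h0, map_zero]
  simp [this]

end Tempered

/-! ### Growth of AR solutions and filtering of the AR equation. -/

section Solution

variable {Ω : Type*} [MeasurableSpace Ω] {P : Measure Ω} [IsProbabilityMeasure P]
variable {H : Type*} [NormedAddCommGroup H] [InnerProductSpace ℂ H]
  [MeasurableSpace H] {k : ℕ} {a : ℕ → H →L[ℂ] H} {ε x : ℤ → Ω → H}

theorem summable_const_add_pow_mul (C : ℝ) (hC : 1 ≤ C) (m : ℕ) {r : ℝ} (hr : 1 < r) :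
    Summable fun n : ℕ => (C + n) ^ m * r⁻¹ ^ n := by
  have hr0 : 0 < r := by linarith
  have h1 := summable_pow_mul_geometric_of_norm_lt_one (R := ℝ) m (r := r⁻¹)
    (by rw [norm_inv, Real.norm_of_nonneg hr0.le]; exact inv_lt_one_of_one_lt₀ hr)
  have h2 := ((summable_nat_add_iff 1).2 h1).mul_left (C ^ m * r)
  refine Summable.of_nonneg_of_le (fun n => by positivity) (fun n => ?_) h2
  calc (C + n) ^ m * r⁻¹ ^ n ≤ (C * (n + 1)) ^ m * r⁻¹ ^ n := by
        gcongr
        nlinarith [(Nat.cast_nonneg n : (0 : ℝ) ≤ n)]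
    _ = C ^ m * r * (((n + 1 : ℕ) : ℝ) ^ m * r⁻¹ ^ (n + 1)) := by
        rw [mul_pow, pow_succ]; push_cast; field_simp

theorem IsARSolution.integrable (hx : IsARSolution P k a ε x) (t : ℤ) : Integrable (x t) P :=
  (hx.memLp t).integrable one_le_two

theorem IsARSolution.temperedMean (hx : IsARSolution P k a ε x) : TemperedMean P x := by
  obtain ⟨M, m, hM⟩ := hx.growth
  intro r hr t
  have hr0 : 0 < r := by linarith
  -- The growth bound only concerns times `≤ 0`, so the first `j` terms are dropped.
  set j : ℕ := t.toNat with hj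
  refine (summable_nat_add_iff j).1 ?_
  set C : ℝ := 1 + |(t : ℝ)| + j with hC
  have hC1 : 1 ≤ C := by 
    rw [hC]; have := abs_nonneg (t : ℝ); have := Nat.cast_nonneg (α := ℝ) j; linarith
  have hs := ((summable_geometric_of_lt_one (r := r⁻¹) (by positivity)
    (inv_lt_one_of_one_lt₀ hr)).add ((summable_const_add_pow_mul C hC1 m hr).mul_left |M|))
  refine Summable.of_nonneg_of_le
    (fun n => mul_nonneg (integral_nonneg fun _ => norm_nonneg _) (by positivity)) (fun n => ?_) hs
  have ht0 : t - (n + j : ℕ) ≤ 0 := by push_cast; omega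
  have h1 : ∫ ω, ‖x (t - (n + j : ℕ)) ω‖ ∂P ≤ 1 + |M| * (C + n) ^ m := by
    have hsq : Integrable (fun ω => ‖x (t - (n + j : ℕ)) ω‖ ^ 2) P :=
      (memLp_two_iff_integrable_sq_norm (hx.memLp _).1).1 (hx.memLp _)
    calc ∫ ω, ‖x (t - (n + j : ℕ)) ω‖ ∂P ≤ ∫ ω, (1 + ‖x (t - (n + j : ℕ)) ω‖ ^ 2) ∂P := by
          refine integral_mono (hx.integrable _).norm ((integrable_const _).add hsq) fun ω => ?_
          change ‖x (t - (n + j : ℕ)) ω‖ ≤ 1 + ‖x (t - (n + j : ℕ)) ω‖ ^ 2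
          nlinarith [sq_nonneg (‖x (t - (n + j : ℕ)) ω‖ - 1), norm_nonneg (x (t - (n + j : ℕ)) ω)]
      _ = 1 + ∫ ω, ‖x (t - (n + j : ℕ)) ω‖ ^ 2 ∂P := by
          rw [integral_add (integrable_const _) hsq]; simp
      _ ≤ 1 + |M| * (C + n) ^ m := by
          gcongr
          refine (hM _ ht0).trans ?_
          have h2 : 1 + |((t - (n + j : ℕ) : ℤ) : ℝ)| ≤ C + n := by
            push_cast
            have h3 := abs_sub (t : ℝ) ((n : ℝ) + j)
            rw [abs_of_nonneg (by positivity : (0 : ℝ) ≤ (n : ℝ) + j)] at h3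
            rw [hC]; linarith
          calc M * (1 + |((t - (n + j : ℕ) : ℤ) : ℝ)|) ^ m
              ≤ |M| * (1 + |((t - (n + j : ℕ) : ℤ) : ℝ)|) ^ m := by
                gcongr; exact le_abs_self M
            _ ≤ |M| * (C + n) ^ m := by gcongr
  have h4 : r⁻¹ ^ (n + j) ≤ r⁻¹ ^ n :=
    pow_le_pow_of_le_one (by positivity) (inv_le_one_of_one_le₀ hr.le) (by omega)
  calc (∫ ω, ‖x (t - (n + j : ℕ)) ω‖ ∂P) * r⁻¹ ^ (n + j)
      ≤ (1 + |M| * (C + n) ^ m) * r⁻¹ ^ n := by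
        refine mul_le_mul h1 h4 (by positivity) ?_
        have : 0 ≤ C + n := by positivity
        positivity
    _ = _ := by ring

/-- The noise is a finite combination of lags of the solution and inherits its growth. -/
theorem IsARSolution.noise_temperedMean (hx : IsARSolution P k a ε x) : TemperedMean P ε := by
  intro r hr t
  have hT := hx.temperedMean r hr
  have hr0 : 0 < r := by linarith
  have hs := (hT t).add (summable_sum (s := Finset.Icc 1 k)
    fun h _ => (hT (t - h)).mul_left ‖a h‖)
  refine Summable.of_nonneg_of_le
    (fun n => mul_nonneg (integral_nonneg fun _ => norm_nonneg _) (by positivity)) (fun n => ?_) hs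
  have hin : ∀ h ∈ Finset.Icc 1 k, Integrable (fun ω => ‖a h‖ * ‖x (t - n - h) ω‖) P :=
    fun h _ => (hx.integrable _).norm.const_mul _
  have h1 : ∫ ω, ‖ε (t - n) ω‖ ∂P ≤ (∫ ω, ‖x (t - n) ω‖ ∂P) +
      ∑ h ∈ Finset.Icc 1 k, ‖a h‖ * ∫ ω, ‖x (t - n - h) ω‖ ∂P := by
    calc ∫ ω, ‖ε (t - n) ω‖ ∂P
        ≤ ∫ ω, (‖x (t - n) ω‖ + ∑ h ∈ Finset.Icc 1 k, ‖a h‖ * ‖x (t - n - h) ω‖) ∂P := by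
          refine integral_mono_of_nonneg (ae_of_all _ fun _ => norm_nonneg _)
            ((hx.integrable _).norm.add (integrable_finsetSum _ hin)) ?_
          filter_upwards [hx.eqn (t - n)] with ω hω
          have : ε (t - n) ω = x (t - n) ω - ∑ h ∈ Finset.Icc 1 k, a h (x (t - n - h) ω) := by
            rw [hω]; abel
          rw [this]
          refine (norm_sub_le _ _).trans ?_
          gcongr
          exact norm_sum_le_of_le _ fun h _ => (a h).le_opNorm _
      _ = _ := by
          rw [integral_add (hx.integrable _).norm (integrable_finsetSum _ hin),
            integral_finsetSum _ hin]
          simp only [integral_const_mul]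
  calc (∫ ω, ‖ε (t - n) ω‖ ∂P) * r⁻¹ ^ n ≤ ((∫ ω, ‖x (t - n) ω‖ ∂P) +
      ∑ h ∈ Finset.Icc 1 k, ‖a h‖ * ∫ ω, ‖x (t - n - h) ω‖ ∂P) * r⁻¹ ^ n := by gcongr
    _ = _ := by
      rw [add_mul, Finset.sum_mul]
      congr 1
      refine Finset.sum_congr rfl fun h _ => ?_
      rw [mul_assoc, sub_right_comm]

theorem IsARSolution.memLp_centered (hx : IsARSolution P k a ε x) (t : ℤ) :
    MemLp (fun ω => x t ω - ∫ ω', x t ω' ∂P) 2 P := (hx.memLp t).sub (memLp_const _)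

/-- Filtering the noise with `B` amounts to filtering the solution with `B(z) A(z)`. -/
theorem IsARSolution.hasSum_filter {F : Type*} [NormedAddCommGroup F] [NormedSpace ℂ F]
    [CompleteSpace F] (hx : IsARSolution P k a ε x) {B : ℕ → H →L[ℂ] F} {ρ : ℝ} (hρ : 1 < ρ)
    (hB : DiscSummable B ρ) : ∀ᵐ ω ∂P, ∀ (t : ℤ) (S : F),
      HasSum (fun n : ℕ => conv B (arSeq k a) n (x (t - n) ω)) S →
      HasSum (fun n : ℕ => B n (ε (t - n) ω)) S := by
  obtain ⟨r, hr1, hr⟩ := exists_between hρ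
  have hr0 : 0 ≤ r := by linarith
  filter_upwards [ae_all_iff.2 hx.eqn, hx.temperedMean.ae_norm_le hx.integrable hr1] with ω h1 h2
  intro t S hS
  obtain ⟨M, hM⟩ := h2 t
  refine (hasSum_filter_comp_iff hr0 (hB r hr0 hr) (discSummable_arSeq k a ρ r hr0 hr)
    (w := fun t => x t ω) (v := fun t => ε t ω) hM (fun n => ?_)).1 hS
  have h3 := hasSum_arSeq_apply k a
    (fun m => ContinuousLinearMap.apply ℂ H (x (t - n - m) ω))
  have h4 : ε (t - n) ω = x (t - n) ω - ∑ h ∈ Finset.Icc 1 k, a h (x (t - n - h) ω) := by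
    rw [h1 (t - n)]; abel
  rw [h4]
  simpa using h3

end Solution


/-! ### Scalar filters of vector noise are I(0). -/

section ScalarFilter

variable {Ω : Type*} [MeasurableSpace Ω] {P : Measure Ω} [IsProbabilityMeasure P]
variable {H : Type*} [NormedAddCommGroup H] [InnerProductSpace ℂ H] [CompleteSpace H]
  [MeasurableSpace H] {ε : ℤ → Ω → H}

/-- A scalar filter of a nondegenerate white noise whose transfer function has no zeros on the unit
circle is integrated of order zero. -/
theorem isIntegratedZero_of_filter (hε : IsWhiteNoise P ε)
    (hnd : ∀ v : H, v ≠ 0 → crossCov P (ε 0) (ε 0) v v ≠ 0) (hT : TemperedMean P ε)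
    {ℓ : ℕ → H →L[ℂ] ℂ} {L : ℂ → H →L[ℂ] ℂ} {ρ : ℝ} (hρ : 1 < ρ)
    (hL : ∀ z : ℂ, ‖z‖ < ρ → HasSum (fun n => z ^ n • ℓ n) (L z))
    (hL0 : ∀ z : ℂ, ‖z‖ = 1 → L z ≠ 0) {u : ℤ → Ω → ℂ} (hu : ∀ t, Measurable (u t))
    (hfil : ∀ t : ℤ, ∀ᵐ ω ∂P, HasSum (fun n : ℕ => ℓ n (ε (t - n) ω)) (u t ω)) :
    IsIntegratedZero P u := by
  have hℓ := discSummable_of_hasSum hL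
  have hℓ1 : Summable fun n => ‖ℓ n‖ := hℓ.summable_norm hρ
  have hLd := differentiableOn_of_hasSum hL
  obtain ⟨R, β, σ, hR, hσ, hβ, hβ0, hβne, hfac⟩ := exists_spectral_factor hρ
    (g := fun z => hε.fn 0 (L z)) ((hε.fn 0).differentiable.comp_differentiableOn hLd)
    fun z hz => hε.fn_zero_injective hnd (hL0 z hz)
  set R' := min R ρ
  have hR' : 1 < R' := lt_min hR hρ
  obtain ⟨b, hb, hbs⟩ := exists_coeff hβ
  -- `m` is the whitening filter `β⁻¹ L`; its output `N` is the scalar noise of the representation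
  -- and `β` its transfer function.
  obtain ⟨m, hm, hms⟩ := exists_coeff (f := fun z => (β z)⁻¹ • L z) (ρ := R')
    (((hβ.mono (Metric.ball_subset_ball (min_le_left _ _))).inv fun z _ => hβne z).smul
      (hLd.mono (Metric.ball_subset_ball (min_le_right _ _))))
  have hm1 : Summable fun n => ‖m n‖ := hm.summable_norm hR'
  set B : ℕ → ℂ →L[ℂ] ℂ := fun n => b n • ContinuousLinearMap.id ℂ ℂ with hB
  have hBs : ∀ z : ℂ, ‖z‖ < R → HasSum (fun n => z ^ n • B n)
      (β z • ContinuousLinearMap.id ℂ ℂ) := fun z hz => by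
    have := (hbs z hz).smul_const (ContinuousLinearMap.id ℂ ℂ)
    simpa only [hB, smul_smul, smul_eq_mul] using this
  have hBd : DiscSummable B R := discSummable_of_hasSum hBs
  have hconv : conv B m = ℓ := by
    refine coeff_unique (ρ := R') (f := L) (by linarith) (fun z hz => ?_)
      fun z hz => hL z (hz.trans_le (min_le_right _ _))
    have hzR : ‖z‖ < R := hz.trans_le (min_le_left _ _)
    have h1 := hasSum_conv (hBd ‖z‖ (norm_nonneg _) hzR) (hm ‖z‖ (norm_nonneg _) hz)
      (hBs z hzR) (hms z hz)
    have h2 : (β z • ContinuousLinearMap.id ℂ ℂ) ∘L ((β z)⁻¹ • L z) = L z := by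
      ext w
      simp [inv_mul_cancel_left₀ (hβne z)]
    rwa [h2] at h1
  have hinner := hasSum_inner_of_norm_const (p := fun n => hε.fn 0 (m n))
    (Summable.of_nonneg_of_le (fun _ => norm_nonneg _) (fun n => (hε.fn 0).le_opNorm _)
      (hm1.mul_left _)) (Q := fun z => hε.fn 0 ((β z)⁻¹ • L z)) (σ := σ)
    (fun z hz => by
      have h1 := (hms z (by rw [hz]; exact hR')).mapL (hε.fn 0)
      simpa only [map_smul] using h1)
    (fun z hz => by
      rw [map_smul, norm_smul, norm_inv, mul_pow, hfac z hz]
      have : ‖β z‖ ≠ 0 := norm_ne_zero_iff.2 (hβne z)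
      field_simp)
  set N : ℤ → Lp ℂ 2 P := hε.filterLp m with hN
  have hNN : ∀ (t : ℤ) (h : ℕ), ⟪N t, N (t + h)⟫_ℂ = if h = 0 then (σ : ℂ) else 0 := fun t h =>
    (hε.hasSum_inner_filterLp hm1 t h).unique (hinner h)
  have hNlt : ∀ s t, s < t → ⟪N s, N t⟫_ℂ = 0 := by
    intro s t hst
    have h1 := hNN s (t - s).toNat
    rwa [show s + ((t - s).toNat : ℤ) = t by omega, if_neg (by omega)] at h1
  have hwn : IsWhiteNoise P (fun t => (N t : Ω → ℂ)) := by
    refine isWhiteNoise_of_inner (σ := σ) (by exact_mod_cast hσ.ne')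
      (fun t => hε.integral_filterLp hm1 t) (fun t => ?_) fun s t hst => ?_
    · simpa using hNN t 0
    · rcases lt_or_gt_of_ne hst with h | h
      · exact hNlt s t h
      · rw [← inner_conj_symm, hNlt t s h, map_zero]
  have hmean : ∀ t, ∫ ω, u t ω ∂P = 0 := fun t => by
    rw [integral_congr_ae (hε.ae_eq_filterLp hℓ1 (hfil t)), hε.integral_filterLp hℓ1]
  refine ⟨fun t => N t, B, ⟨hu, fun t => ?_, hwn, ?_, ⟨R, hR, fun z hz => hBd _ (norm_nonneg _) hz⟩,
    fun t => ?_⟩, ?_⟩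
  · exact ((Lp.memLp _).integrable one_le_two).congr (hε.ae_eq_filterLp hℓ1 (hfil t)).symm
  · have h1 := hbs 0 (by simp; linarith)
    have h2 := hasSum_single (f := fun n : ℕ => (0 : ℂ) ^ n • b n) 0 (fun n hn => by simp [hn])
    have h3 := h1.unique h2
    rw [hβ0] at h3
    have h4 : b 0 = 1 := by simpa using h3.symm
    rw [hB]
    simp only [h4, one_smul]
  · obtain ⟨r, hr1, hr⟩ := exists_between hR'
    have hr0 : 0 ≤ r := by linarith
    have hNt : ∀ᵐ ω ∂P, ∀ t : ℤ, HasSum (fun n : ℕ => m n (ε (t - n) ω)) (N t ω) :=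
      ae_all_iff.2 fun t => hε.ae_hasSum_filterLp hm1 t
    filter_upwards [hNt, hfil t,
      hT.ae_norm_le (fun t => (hε.memLp t).integrable one_le_two) hr1] with ω h1 h2 h3
    obtain ⟨M, hM⟩ := h3 t
    rw [hmean, sub_zero]
    refine (hasSum_filter_comp_iff hr0 (hBd r hr0 (hr.trans_le (min_le_left _ _)))
      (hm r hr0 hr) (w := fun t => ε t ω) (v := fun t => N t ω) hM fun n => h1 _).1 ?_
    rw [hconv]
    exact h2
  · have h1 := hBs 1 (by simpa using hR)
    simp only [one_pow, one_smul] at h1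
    rw [h1.tsum_eq]
    intro h0
    have := congrArg (fun f => f (1 : ℂ)) h0
    exact hβne 1 (by simpa using this)

end ScalarFilter

/-! ### Left Jordan chains and telescoping of the noise. -/

section Chain

variable {H : Type*} [NormedAddCommGroup H] [InnerProductSpace ℂ H]
  {V : Type*} [AddCommGroup V] [Module ℂ V]

theorem sub_eq_sum_range_sub {V : Type*} [AddCommGroup V] (X : ℤ → V) (t : ℤ) (h : ℕ) :
    X t - X (t - h) = ∑ i ∈ Finset.range h, (X (t - i) - X (t - i - 1)) := by
  induction h with
  | zero => simp
  | succ h ih =>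
    rw [Finset.sum_range_succ, ← ih]
    push_cast
    rw [← sub_sub]; abel

/-- A Jordan chain from the left turns a noise into the difference of a process that is
expressed through the differences of the solution. -/
theorem noise_eq_diff_of_left_chain {k : ℕ} {a : ℕ → H →L[ℂ] H}
    {X e : ℤ → (H →L[ℂ] ℂ) →ₗ[ℂ] V}
    (he : ∀ t φ, e t φ = X t φ - ∑ h ∈ Finset.Icc 1 k, X (t - h) (φ ∘L a h))
    {φ₀ φ₁ : H →L[ℂ] ℂ} (h₀ : φ₀ ∘L arCoeff k a 0 = 0)
    (h₁ : φ₁ ∘L arCoeff k a 0 = -(φ₀ ∘L arCoeff k a 1)) {D : (H →L[ℂ] ℂ) → ℤ → V}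
    (hD : ∀ φ t, D φ t = X t φ - X (t - 1) φ) {W : ℤ → V}
    (hW : ∀ t, W t = -e t φ₁ +
      ∑ h ∈ Finset.Icc 1 k, ∑ i ∈ Finset.range h, D (φ₁ ∘L a h) (t - i) -
      ∑ h ∈ Finset.Icc 1 k, ∑ i ∈ Finset.range h, ∑ l ∈ Finset.range i, D (φ₀ ∘L a h) (t - l))
    (t : ℤ) : e t φ₀ = W t - W (t - 1) := by
  -- `A(L) = A₀` plus a combination of lagged differences, tested against `φ`.
  have h1 : ∀ φ t, e t φ = X t (φ ∘L arCoeff k a 0) +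
      ∑ h ∈ Finset.Icc 1 k, ∑ i ∈ Finset.range h, D (φ ∘L a h) (t - i) := by
    intro φ t
    have h2 : φ ∘L arCoeff k a 0 = φ - ∑ h ∈ Finset.Icc 1 k, φ ∘L a h := by
      ext x; simp [arCoeff]
    rw [he, h2, map_sub, map_sum, sub_add, ← Finset.sum_sub_distrib]
    congr 1
    refine Finset.sum_congr rfl fun h _ => ?_
    simp only [hD]
    rw [← sub_eq_sum_range_sub (fun t => X t (φ ∘L a h)) t h]
    abel
  have h2 : ∀ t, D (φ₀ ∘L arCoeff k a 1) t =
      ∑ h ∈ Finset.Icc 1 k, ∑ _i ∈ Finset.range h, D (φ₀ ∘L a h) t := by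
    intro t
    have h3 : φ₀ ∘L arCoeff k a 1 = ∑ h ∈ Finset.Icc 1 k, (h : ℂ) • (φ₀ ∘L a h) := by
      rw [arCoeff_one_eq]
      ext x; simp
    rw [h3, hD, map_sum, map_sum, ← Finset.sum_sub_distrib]
    refine Finset.sum_congr rfl fun h _ => ?_
    rw [map_smul, map_smul, ← smul_sub, ← hD, Finset.sum_const, Finset.card_range,
      Nat.cast_smul_eq_nsmul]
  -- The zeroth-order term vanishes since `φ₀ A₀ = 0`; a second expansion isolates `φ₀ A₁ Δx`, which
  -- the chain turns into `-φ₁ A₀ Δx`, again a difference.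
  have h3 : ∀ t, e t φ₀ = D (φ₀ ∘L arCoeff k a 1) t -
      ∑ h ∈ Finset.Icc 1 k, ∑ i ∈ Finset.range h, ∑ l ∈ Finset.range i,
        (D (φ₀ ∘L a h) (t - l) - D (φ₀ ∘L a h) (t - l - 1)) := by
    intro t
    rw [h1, h₀, map_zero, zero_add, h2, ← Finset.sum_sub_distrib]
    refine Finset.sum_congr rfl fun h _ => ?_
    rw [← Finset.sum_sub_distrib]
    refine Finset.sum_congr rfl fun i _ => ?_
    rw [← sub_eq_sum_range_sub]; abel
  have h4 := h1 φ₁ t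
  have h5 := h1 φ₁ (t - 1)
  rw [h₁, map_neg] at h4 h5
  rw [h3, hD, hW, hW, h4, h5]
  simp only [Finset.sum_sub_distrib, sub_right_comm _ (1 : ℤ)]
  abel

end Chain

/-! ### An I(1) solution forces `S₁` to be injective on `Ker A₀`. -/

section Necessity

theorem IsLinearProcess.summable_norm {Ω : Type*} [MeasurableSpace Ω] {P : Measure Ω}
    {K : Type*} [NormedAddCommGroup K] [InnerProductSpace ℂ K]
    [CompleteSpace K] [MeasurableSpace K] [BorelSpace K] {η u : ℤ → Ω → K} {B : ℕ → K →L[ℂ] K}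
    (hB : IsLinearProcess P η B u) : Summable fun n => ‖B n‖ := by
  obtain ⟨ρ, hρ, h⟩ := hB.absConv
  simpa using h 1 (by simpa using hρ)

variable {Ω : Type*} [MeasurableSpace Ω] {P : Measure Ω} [IsProbabilityMeasure P]
variable {H : Type*} [NormedAddCommGroup H] [InnerProductSpace ℂ H] [CompleteSpace H]
  [MeasurableSpace H] {k : ℕ} {a : ℕ → H →L[ℂ] H} {ε x : ℤ → Ω → H}

theorem IsARSolution.integral_eqn (hε : IsWhiteNoise P ε) (hx : IsARSolution P k a ε x) (t : ℤ) :
    ∫ ω, x t ω ∂P = ∑ h ∈ Finset.Icc 1 k, a h (∫ ω, x (t - h) ω ∂P) := by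
  have hin : ∀ h ∈ Finset.Icc 1 k, Integrable (fun ω => a h (x (t - h) ω)) P :=
    fun h _ => (a h).integrable_comp (hx.integrable _)
  rw [integral_congr_ae (hx.eqn t), integral_add (integrable_finsetSum _ hin)
    ((hε.memLp t).integrable one_le_two), integral_finsetSum _ hin, hε.mean_zero, add_zero]
  exact Finset.sum_congr rfl fun h _ => (a h).integral_comp_comm (hx.integrable _)

/-- Centering is harmless because the means satisfy the same recursion without noise. -/
theorem IsARSolution.fn_eq (hε : IsWhiteNoise P ε) (hx : IsARSolution P k a ε x) (t : ℤ)
    (φ : H →L[ℂ] ℂ) : hε.fn t φ = funLp (hx.memLp_centered t) φ -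
      ∑ h ∈ Finset.Icc 1 k, funLp (hx.memLp_centered (t - h)) (φ ∘L a h) := by
  refine Lp.ext ?_
  have h1 : ∀ᵐ ω ∂P, ∀ h : ℕ, funLp (hx.memLp_centered (t - h)) (φ ∘L a h) ω =
      φ (a h (x (t - h) ω - ∫ ω', x (t - h) ω' ∂P)) := ae_all_iff.2 fun h => coeFn_funLp _ _
  filter_upwards [hx.eqn t, h1, coeFn_funLp (hε.memLp t) φ, coeFn_funLp (hx.memLp_centered t) φ,
    Lp.coeFn_sub (funLp (hx.memLp_centered t) φ)
      (∑ h ∈ Finset.Icc 1 k, funLp (hx.memLp_centered (t - h)) (φ ∘L a h)),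
    Lp.coeFn_fun_finsetSum (Finset.Icc 1 k)
      (fun h : ℕ => funLp (hx.memLp_centered (t - h)) (φ ∘L a h))] with ω h2 h3 h4 h5 h6 h7
  rw [h6, Pi.sub_apply, h7, h5]
  refine h4.trans ?_
  simp only [h3]
  rw [← map_sum, ← map_sub, hx.integral_eqn hε, h2]
  congr 1
  simp only [map_sub, Finset.sum_sub_distrib]
  abel

/-- A left chain would make the random walk of `φ₀ ε` bounded in L², since centered functionals of
an I(0) process `Δx` are bounded uniformly in time. -/
theorem sOne_injOn_of_isIntegrated [BorelSpace H] (hA : IsUnitRootOfFiniteType k a)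
    (hε : IsWhiteNoise P ε)
    (hnd : ∀ v : H, v ≠ 0 → crossCov P (ε 0) (ε 0) v v ≠ 0) (hx : IsARSolution P k a ε x)
    (hI : IsIntegrated P 1 x) :
    ∀ v ∈ (arCoeff k a 0).ker, sOne (arCoeff k a 0) (arCoeff k a 1) v = 0 → v = 0 := by
  intro v hv hS
  by_contra hv0
  have hF := isFredholm_arCoeff hA
  obtain ⟨φ₀, φ₁, hφ₀, h₀, h₁⟩ := exists_left_chain hF
    (finrank_ker_le_of_frequently_isUnit hF (exists_isUnit_near hA)) hv hv0 hS
  obtain ⟨η, B, hB, -⟩ := hI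
  have hη := hB.whiteNoise
  have hB1 : ∀ φ : H →L[ℂ] ℂ, Summable fun n => ‖φ ∘L B n‖ := fun φ =>
    Summable.of_nonneg_of_le (fun _ => norm_nonneg _)
      (fun n => ContinuousLinearMap.opNorm_comp_le _ _) (hB.summable_norm.mul_left ‖φ‖)
  set X : ℤ → (H →L[ℂ] ℂ) →ₗ[ℂ] Lp ℂ 2 P := fun t => (funLp (hx.memLp_centered t)).toLinearMap
  set D : (H →L[ℂ] ℂ) → ℤ → Lp ℂ 2 P := fun φ t => hη.filterLp (fun n => φ ∘L B n) t with hDdef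
  have hD : ∀ φ t, D φ t = X t φ - X (t - 1) φ := by
    intro φ t
    refine Lp.ext ?_
    have h1 : ∀ᵐ ω ∂P, HasSum (fun n : ℕ => (φ ∘L B n) (η (t - n) ω))
        (φ ((x t ω - x (t - 1) ω) - ∫ ω', (x t ω' - x (t - 1) ω') ∂P)) := by
      filter_upwards [hB.eq_filter t] with ω hω
      exact hω.mapL φ
    filter_upwards [hη.ae_eq_filterLp (hB1 φ) h1, coeFn_funLp (hx.memLp_centered t) φ,
      coeFn_funLp (hx.memLp_centered (t - 1)) φ,
      Lp.coeFn_sub (X t φ) (X (t - 1) φ)] with ω h2 h3 h4 h5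
    rw [h5, Pi.sub_apply]
    refine h2.symm.trans ?_
    refine Eq.trans ?_ (congrArg₂ (· - ·) h3.symm h4.symm)
    rw [integral_sub (hx.integrable _) (hx.integrable _), ← map_sub]
    congr 1
    abel
  set C : (H →L[ℂ] ℂ) → ℝ := fun φ => ‖hη.fn 0‖ * ∑' n, ‖φ ∘L B n‖
  have hDC : ∀ φ t, ‖D φ t‖ ≤ C φ := fun φ t => hη.norm_filterLp_le (hB1 φ) t
  set W : ℤ → Lp ℂ 2 P := fun t => -hε.fn t φ₁ +
      ∑ h ∈ Finset.Icc 1 k, ∑ i ∈ Finset.range h, D (φ₁ ∘L a h) (t - i) -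
      ∑ h ∈ Finset.Icc 1 k, ∑ i ∈ Finset.range h, ∑ l ∈ Finset.range i, D (φ₀ ∘L a h) (t - l)
  refine hε.not_bounded_sum (hε.fn_zero_injective hnd hφ₀) (w := W)
    (M := ‖hε.fn 0‖ * ‖φ₁‖ + ∑ h ∈ Finset.Icc 1 k, ∑ i ∈ Finset.range h, C (φ₁ ∘L a h) +
      ∑ h ∈ Finset.Icc 1 k, ∑ i ∈ Finset.range h, ∑ l ∈ Finset.range i, C (φ₀ ∘L a h))
    (fun t => ?_) (fun t => ?_)
  · refine (norm_sub_le _ _).trans (add_le_add ((norm_add_le _ _).trans (add_le_add ?_ ?_)) ?_)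
    · rw [norm_neg]; exact hε.norm_fn_le _ _
    · exact norm_sum_le_of_le _ fun h _ => norm_sum_le_of_le _ fun i _ => hDC _ _
    · exact norm_sum_le_of_le _ fun h _ => norm_sum_le_of_le _ fun i _ =>
        norm_sum_le_of_le _ fun l _ => hDC _ _
  · exact noise_eq_diff_of_left_chain (X := X) (e := fun t => (hε.fn t).toLinearMap)
      (fun t φ => hx.fn_eq hε t φ) (ContinuousLinearMap.ext h₀) (ContinuousLinearMap.ext h₁) hD
      (W := W) (fun t => rfl) t

end Necessity


/-! ### Cumulation inverts differencing. -/

section Cumul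

variable {Ω : Type*} {K : Type*} [NormedAddCommGroup K]

theorem cumul_zero (w : ℤ → Ω → K) (ω : Ω) : cumul w 0 ω = 0 := by simp [cumul]

theorem cumul_sub_cumul (w : ℤ → Ω → K) (t : ℤ) (ω : Ω) :
    cumul w t ω - cumul w (t - 1) ω = w t ω := by
  simp only [cumul]
  rcases lt_trichotomy t 1 with h | rfl | h
  · rcases lt_or_eq_of_le (show t ≤ 0 by omega) with h0 | rfl
    · rw [if_neg (by omega), if_pos (by omega), if_neg (by omega), if_pos (by omega),
        sub_add_cancel, ← Finset.add_sum_Ioc_eq_sum_Icc (show t ≤ 0 by omega),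
        ← Finset.sum_congr (show Finset.Icc (t + 1) 0 = Finset.Ioc t 0 from by
          ext; simp) fun _ _ => rfl]
      abel
    · simp
  · simp
  · rw [if_pos (by omega), if_pos (by omega),
      ← Finset.sum_Ico_add_eq_sum_Icc (show 1 ≤ t by omega),
      Finset.sum_congr (show Finset.Icc 1 (t - 1) = Finset.Ico 1 t from by
        ext; simp) fun _ _ => rfl]
    abel

theorem eq_of_forall_sub_eq {V : Type*} [AddCommGroup V] {f g : ℤ → V} (h0 : f 0 = g 0)
    (h : ∀ t, f t - f (t - 1) = g t - g (t - 1)) (t : ℤ) : f t = g t := by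
  induction t using Int.induction_on with
  | zero => exact h0
  | succ n ih =>
    have := h (n + 1)
    rw [add_sub_cancel_right, ih] at this
    exact sub_left_injective this
  | pred n ih =>
    have := h (-n)
    rw [ih] at this
    exact sub_right_injective this

end Cumul

/-! ### Coefficient identities for a simple pole. -/

section Regularized

variable {H : Type*} [NormedAddCommGroup H] [InnerProductSpace ℂ H]
  {k : ℕ} {a : ℕ → H →L[ℂ] H}

/-- The data of a simple pole: `E z = (1 - z) A(z)⁻¹` and `S z = A(z)⁻¹ - (1 - z)⁻¹ E 1` as
analytic functions on a disc of radius larger than one, with their coefficients. -/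
structure IsRegularized (k : ℕ) (a : ℕ → H →L[ℂ] H) (ρ : ℝ) (E S : ℂ → H →L[ℂ] H)
    (e s : ℕ → H →L[ℂ] H) : Prop where
  one_lt : 1 < ρ
  isUnit : ∀ z, ‖z‖ < ρ → z ≠ 1 → IsUnit (arPoly k a z)
  differentiableOn : DifferentiableOn ℂ E (Metric.ball 0 ρ)
  eq_inverse : ∀ z, z ≠ 1 → E z = (1 - z) • Ring.inverse (arPoly k a z)
  eq_inverse_sub : ∀ z, z ≠ 1 → S z = Ring.inverse (arPoly k a z) - (1 - z)⁻¹ • E 1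
  hasSum : ∀ z : ℂ, ‖z‖ < ρ → HasSum (fun n => z ^ n • e n) (E z)
  hasSum' : ∀ z : ℂ, ‖z‖ < ρ → HasSum (fun n => z ^ n • s n) (S z)

variable {ρ : ℝ} {E S : ℂ → H →L[ℂ] H} {e s : ℕ → H →L[ℂ] H}

theorem exists_isRegularized [CompleteSpace H]
    (hA : IsUnitRootOfFiniteType k a)
    (h : ∀ v ∈ (arCoeff k a 0).ker, sOne (arCoeff k a 0) (arCoeff k a 1) v = 0 → v = 0) :
    ∃ ρ E S e s, IsRegularized k a ρ E S e s := by
  obtain ⟨ρ, E, hρ, hE, hu, hEA⟩ := exists_regularized_inverse hA h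
  have hmem : Metric.ball (0 : ℂ) ρ ∈ 𝓝 (1 : ℂ) := Metric.isOpen_ball.mem_nhds (by simpa using hρ)
  -- `S(z) = (E(z) - E(1)) / (1 - z)` is minus the divided difference of `E` at 1, analytic across
  -- 1.
  have hS : DifferentiableOn ℂ (fun z => -dslope E 1 z) (Metric.ball 0 ρ) :=
    ((Complex.differentiableOn_dslope hmem).2 hE).neg
  obtain ⟨e, -, he⟩ := exists_coeff hE
  obtain ⟨s, -, hs⟩ := exists_coeff hS
  refine ⟨ρ, E, _, e, s, hρ, hu, hE, hEA, fun z hz => ?_, he, hs⟩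
  have hz1 : (1 : ℂ) - z ≠ 0 := sub_ne_zero.2 hz.symm
  have h1 : Ring.inverse (arPoly k a z) = (1 - z)⁻¹ • E z := by
    rw [hEA z hz, smul_smul, inv_mul_cancel₀ hz1, one_smul]
  rw [dslope_of_ne _ hz, slope_def_module, h1, ← smul_sub, ← neg_smul, ← inv_neg, neg_sub]

namespace IsRegularized

theorem sub_smul_eq (hR : IsRegularized k a ρ E S e s) (z : ℂ) : (1 - z) • S z = E z - E 1 := by
  by_cases hz : z = 1
  · simp [hz]
  have hz1 : (1 : ℂ) - z ≠ 0 := sub_ne_zero.2 (Ne.symm hz)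
  rw [hR.eq_inverse_sub z hz, smul_sub, smul_smul, mul_inv_cancel₀ hz1, one_smul,
    hR.eq_inverse z hz]

theorem tsum_coeff (hR : IsRegularized k a ρ E S e s) : ∑' n, e n = E 1 := by
  have h1 := hR.hasSum 1 (by simpa using hR.one_lt)
  simpa using h1.tsum_eq

theorem hasSum_inner (hR : IsRegularized k a ρ E S e s) (v : H) {z : ℂ} (hz : ‖z‖ < ρ) :
    HasSum (fun n => z ^ n • (innerSL ℂ v ∘L e n)) (innerSL ℂ v ∘L E z) := by
  have h := (hR.hasSum z hz).mapL (ContinuousLinearMap.compL ℂ H H ℂ (innerSL ℂ v))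
  simpa using h

theorem hasSum_inner' (hR : IsRegularized k a ρ E S e s) (v : H) {z : ℂ} (hz : ‖z‖ < ρ) :
    HasSum (fun n => z ^ n • (innerSL ℂ v ∘L s n)) (innerSL ℂ v ∘L S z) := by
  have h := (hR.hasSum' z hz).mapL (ContinuousLinearMap.compL ℂ H H ℂ (innerSL ℂ v))
  simpa using h

variable [CompleteSpace H]

theorem comp (hR : IsRegularized k a ρ E S e s) {z : ℂ} (hz : ‖z‖ < ρ) :
    E z ∘L arPoly k a z = (1 - z) • ContinuousLinearMap.id ℂ H ∧
      arPoly k a z ∘L E z = (1 - z) • ContinuousLinearMap.id ℂ H :=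
  regularized_comp hR.one_lt hR.differentiableOn hR.isUnit hR.eq_inverse hz

theorem range_one (hR : IsRegularized k a ρ E S e s) : (E 1).range = (arCoeff k a 0).ker :=
  range_regularized_one hR.one_lt hR.differentiableOn hR.isUnit hR.eq_inverse

theorem discSummable (hR : IsRegularized k a ρ E S e s) :
    DiscSummable e ρ := discSummable_of_hasSum hR.hasSum

theorem discSummable' (hR : IsRegularized k a ρ E S e s) :
    DiscSummable s ρ := discSummable_of_hasSum hR.hasSum'

theorem coeff_zero (hR : IsRegularized k a ρ E S e s) : e 0 = ContinuousLinearMap.id ℂ H := by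
  have h0 : ‖(0 : ℂ)‖ < ρ := by rw [norm_zero]; linarith [hR.one_lt]
  have h1 := hasSum_single (f := fun n : ℕ => (0 : ℂ) ^ n • e n) 0 (fun n hn => by simp [hn])
  have h2 := (hR.hasSum 0 h0).unique h1
  have h3 := (hR.comp h0).1
  rw [arPoly_zero, ContinuousLinearMap.comp_id, h2] at h3
  simpa using h3

theorem conv_arSeq (hR : IsRegularized k a ρ E S e s) :
    conv e (arSeq k a) = arSeq 1 fun _ => ContinuousLinearMap.id ℂ H := by
  refine coeff_unique (ρ := ρ) (f := fun z => (1 - z) • ContinuousLinearMap.id ℂ H)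
    (by linarith [hR.one_lt]) (fun z hz => ?_) fun z _ => ?_
  · have h1 := hasSum_conv (hR.discSummable _ (norm_nonneg z) hz)
      (discSummable_arSeq k a ρ _ (norm_nonneg z) hz) (hR.hasSum z hz) (hasSum_arSeq k a z)
    rwa [(hR.comp hz).1] at h1
  · have h1 := hasSum_arSeq 1 (fun _ => ContinuousLinearMap.id ℂ H) z
    have h2 : arPoly 1 (fun _ => ContinuousLinearMap.id ℂ H) z =
        (1 - z) • ContinuousLinearMap.id ℂ H := by simp [arPoly, sub_smul]
    rwa [h2] at h1

theorem conv_diff (hR : IsRegularized k a ρ E S e s) :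
    conv (arSeq 1 fun _ => ContinuousLinearMap.id ℂ H) s =
    fun n => e n - if n = 0 then E 1 else 0 := by
  refine coeff_unique (ρ := ρ) (f := fun z => (1 - z) • S z)
    (by linarith [hR.one_lt]) (fun z hz => ?_) fun z hz => ?_
  · have h1 := hasSum_conv (discSummable_arSeq 1 _ ρ _ (norm_nonneg z) hz)
      (hR.discSummable' _ (norm_nonneg z) hz)
      (hasSum_arSeq 1 (fun _ => ContinuousLinearMap.id ℂ H) z) (hR.hasSum' z hz)
    have h2 : arPoly 1 (fun _ => ContinuousLinearMap.id ℂ H) z ∘L S z = (1 - z) • S z := by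
      ext w; simp [arPoly, sub_smul]
    rwa [h2] at h1
  · have h1 := (hR.hasSum z hz).sub
      (hasSum_ite_eq (0 : ℕ) (E 1))
    rw [← hR.sub_smul_eq] at h1
    refine h1.congr_fun fun n => ?_
    by_cases hn : n = 0
    · simp [hn]
    · simp [hn]

theorem isLaurentExpansion (hR : IsRegularized k a ρ E S e s) : ∃ C : ℕ → H →L[ℂ] H,
    IsLaurentExpansionAtOne (arPoly k a) 1 C ∧ C 0 = E 1 := by
  have hd : DifferentiableOn ℂ (fun u : ℂ => E (1 - u)) (Metric.ball 0 (ρ - 1)) := by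
    refine hR.differentiableOn.comp (by fun_prop) fun u hu => ?_
    rw [Metric.mem_ball, dist_zero_right] at hu ⊢
    calc ‖1 - u‖ ≤ ‖(1 : ℂ)‖ + ‖u‖ := norm_sub_le _ _
      _ < 1 + (ρ - 1) := by rw [norm_one]; gcongr
      _ = ρ := by ring
  obtain ⟨C, -, hC⟩ := exists_coeff hd
  have hρ := hR.one_lt
  refine ⟨C, ⟨ρ - 1, by linarith, fun z hz hz1 => ⟨hR.isUnit z ?_ hz1, ?_⟩⟩, ?_⟩
  · calc ‖z‖ = ‖(z - 1) + 1‖ := by rw [sub_add_cancel]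
      _ ≤ ‖z - 1‖ + ‖(1 : ℂ)‖ := norm_add_le _ _
      _ < (ρ - 1) + 1 := by rw [norm_one]; gcongr
      _ = ρ := by ring
  · have hz0 : (1 : ℂ) - z ≠ 0 := sub_ne_zero.2 (Ne.symm hz1)
    have h1 := (hC (1 - z) (by rwa [norm_sub_rev])).const_smul (1 - z)⁻¹
    rw [sub_sub_cancel, hR.eq_inverse z hz1, smul_smul, inv_mul_cancel₀ hz0, one_smul] at h1
    refine h1.congr_fun fun n => ?_
    rw [smul_smul, zpow_sub₀ hz0, zpow_natCast, Nat.cast_one, zpow_one, div_eq_mul_inv, mul_comm]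
  · have h1 := hasSum_single (f := fun n : ℕ => (0 : ℂ) ^ n • C n) 0 (fun n hn => by simp [hn])
    have h2 := (hC 0 (by rw [norm_zero]; linarith)).unique h1
    simpa using h2.symm

/-- Off 1 the functional is tested on `A(z) v`, where `E(z) A(z) v = (1 - z) v`; at 1 it is tested
on a preimage of `v`, available because `Im (E 1) = Ker A₀`. -/
theorem inner_comp_ne_zero (hR : IsRegularized k a ρ E S e s)
    {v : H} (hv0 : v ≠ 0) (hv : v ∈ (arCoeff k a 0).ker) {z : ℂ}
    (hz : ‖z‖ < ρ) : innerSL ℂ v ∘L E z ≠ 0 := by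
  intro h0
  by_cases hz1 : z = 1
  · subst hz1
    rw [← hR.range_one] at hv
    obtain ⟨w, hw⟩ := hv
    have h1 : ⟪v, E 1 w⟫_ℂ = 0 := congrArg (fun f => f w) h0
    rw [show E 1 w = v from hw] at h1
    exact hv0 (inner_self_eq_zero.1 h1)
  · have h1 := congrArg (fun f => f (arPoly k a z v)) h0
    have h2 : E z (arPoly k a z v) = (1 - z) • v := congrArg (fun f => f v) (hR.comp hz).1
    simp only [ContinuousLinearMap.comp_apply, h2, innerSL_apply_apply, zero_apply, inner_smul_right] at h1
    rcases mul_eq_zero.1 h1 with h3 | h3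
    · exact hz1 (sub_eq_zero.1 h3).symm
    · exact hv0 (inner_self_eq_zero.1 h3)

theorem inner_apply_one (hR : IsRegularized k a ρ E S e s)
    {v : H} (hv : v ∈ tauZero k a) (w : H) : ⟪v, E 1 w⟫_ℂ = 0 := by
  have h1 : E 1 w ∈ (arCoeff k a 0).ker := by rw [← hR.range_one]; exact ⟨w, rfl⟩
  exact Submodule.inner_left_of_mem_orthogonal h1 hv

/-- For `v ∈ τ₀` the polar part is annihilated, as `v ⟂ Im (E 1)`, so `⟨v, S(z) ·⟩` coincides with
`⟨v, A(z)⁻¹ ·⟩` off 1 and continuity covers 1. -/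
theorem inner_comp_arPoly (hR : IsRegularized k a ρ E S e s)
    {v : H} (hv : v ∈ tauZero k a) {z : ℂ} (hz : ‖z‖ < ρ) :
    (innerSL ℂ v ∘L S z) ∘L arPoly k a z = innerSL ℂ v := by
  have key : ∀ z : ℂ, ‖z‖ < ρ → z ≠ 1 → (innerSL ℂ v ∘L S z) ∘L arPoly k a z = innerSL ℂ v := by
    intro z hz hz1
    ext w
    have hz0 : (1 : ℂ) - z ≠ 0 := sub_ne_zero.2 (Ne.symm hz1)
    have h1 := congrArg (fun f => ⟪v, f (arPoly k a z w)⟫_ℂ) (hR.sub_smul_eq z)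
    have h2 : E z (arPoly k a z w) = (1 - z) • w := congrArg (fun f => f w) (hR.comp hz).1
    simp only [smul_apply, sub_apply, inner_smul_right,
      inner_sub_right, h2, hR.inner_apply_one hv, sub_zero] at h1
    exact mul_left_cancel₀ hz0 h1
  by_cases hz1 : z = 1
  swap
  · exact key z hz hz1
  have hmem : Metric.ball (0 : ℂ) ρ ∈ 𝓝 z := Metric.isOpen_ball.mem_nhds (by simpa using hz)
  have hSc : ContinuousAt S z :=
    ((differentiableOn_of_hasSum hR.hasSum').differentiableAt hmem).continuousAt
  have hAc : ContinuousAt (arPoly k a) z := (differentiable_arPoly k a z).continuousAt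
  refine eq_of_eventuallyEq_punctured
    (f := fun z => (innerSL ℂ v ∘L S z) ∘L arPoly k a z) (g := fun _ => innerSL ℂ v)
    ((continuousAt_const.clm_comp hSc).clm_comp hAc) continuousAt_const ?_
  filter_upwards [self_mem_nhdsWithin, nhdsWithin_le_nhds hmem] with w h1 h2
  exact key w (by simpa using h2) (by rw [← hz1]; exact h1)

theorem inner_comp_ne_zero' (hR : IsRegularized k a ρ E S e s)
    {v : H} (hv0 : v ≠ 0) (hv : v ∈ tauZero k a) {z : ℂ}
    (hz : ‖z‖ < ρ) : innerSL ℂ v ∘L S z ≠ 0 := by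
  intro h0
  have h1 := hR.inner_comp_arPoly hv hz
  rw [h0, ContinuousLinearMap.zero_comp] at h1
  have h2 : ⟪v, v⟫_ℂ = 0 := (congrArg (fun f => f v) h1).symm
  exact hv0 (inner_self_eq_zero.1 h2)

theorem conv_inner (hR : IsRegularized k a ρ E S e s) {v : H} (hv : v ∈ tauZero k a) :
    conv (fun n => innerSL ℂ v ∘L s n) (arSeq k a) = fun n => if n = 0 then innerSL ℂ v else 0 := by
  refine coeff_unique (ρ := ρ) (f := fun _ => innerSL ℂ v) (by linarith [hR.one_lt])
    (fun z hz => ?_) fun z _ => ?_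
  · have h1 := hasSum_conv
      (discSummable_of_hasSum (fun z hz => hR.hasSum_inner' v hz) _ (norm_nonneg z) hz)
      (discSummable_arSeq k a ρ _ (norm_nonneg z) hz) (hR.hasSum_inner' v hz) (hasSum_arSeq k a z)
    rwa [hR.inner_comp_arPoly hv hz] at h1
  · refine (hasSum_ite_eq (0 : ℕ) (innerSL ℂ v)).congr_fun fun n => ?_
    by_cases hn : n = 0 <;> simp [hn]

end IsRegularized

end Regularized


/-! ### Increments of the solution and the common trends representation. -/

section CommonTrends

theorem hasSum_arSeq_diff {V : Type*} [NormedAddCommGroup V] [InnerProductSpace ℂ V]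
    (w : ℤ → V) (t : ℤ) :
    HasSum (fun n : ℕ => arSeq 1 (fun _ => ContinuousLinearMap.id ℂ V) n (w (t - n)))
      (w t - w (t - 1)) := by
  simpa using hasSum_arSeq_apply 1 (fun _ => ContinuousLinearMap.id ℂ V)
    (fun n => ContinuousLinearMap.apply ℂ V (w (t - n)))

variable {Ω : Type*} [MeasurableSpace Ω] {P : Measure Ω} [IsProbabilityMeasure P]
variable {H : Type*} [NormedAddCommGroup H] [InnerProductSpace ℂ H] [CompleteSpace H]
  [MeasurableSpace H] {k : ℕ} {a : ℕ → H →L[ℂ] H} {ε x : ℤ → Ω → H}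
  {ρ : ℝ} {E S : ℂ → H →L[ℂ] H} {e s : ℕ → H →L[ℂ] H}

theorem IsARSolution.hasSum_diff (hx : IsARSolution P k a ε x)
    (hR : IsRegularized k a ρ E S e s) :
    ∀ᵐ ω ∂P, ∀ t : ℤ, HasSum (fun n : ℕ => e n (ε (t - n) ω)) (x t ω - x (t - 1) ω) := by
  filter_upwards [hx.hasSum_filter hR.one_lt hR.discSummable] with ω h t
  refine h t _ ?_
  rw [hR.conv_arSeq]
  exact hasSum_arSeq_diff (fun t => x t ω) t

theorem IsARSolution.integral_diff [BorelSpace H] (hε : IsWhiteNoise P ε)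
    (hx : IsARSolution P k a ε x) (hR : IsRegularized k a ρ E S e s) (t : ℤ) :
    ∫ ω, (x t ω - x (t - 1) ω) ∂P = 0 := by
  obtain ⟨y, -, -, h0, hy⟩ := hx.noise_temperedMean.exists_filter
    (fun t => (hε.memLp t).integrable one_le_two) hε.mean_zero hR.one_lt hR.discSummable
  rw [← h0 t]
  refine integral_congr_ae ?_
  filter_upwards [hy t, hx.hasSum_diff hR] with ω h1 h2 using (h2 t).unique h1

theorem IsARSolution.integral_eq [BorelSpace H] (hε : IsWhiteNoise P ε)
    (hx : IsARSolution P k a ε x) (hR : IsRegularized k a ρ E S e s) (t : ℤ) :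
    ∫ ω, x t ω ∂P = ∫ ω, x 0 ω ∂P := by
  refine eq_of_forall_sub_eq (f := fun t => ∫ ω, x t ω ∂P) (g := fun _ => ∫ ω, x 0 ω ∂P) rfl
    (fun t => ?_) t
  rw [sub_self, ← integral_sub (hx.integrable _) (hx.integrable _), hx.integral_diff hε hR]

theorem IsARSolution.isIntegrated [BorelSpace H] [SecondCountableTopology H]
    (hA : IsUnitRootOfFiniteType k a) (hε : IsWhiteNoise P ε)
    (hx : IsARSolution P k a ε x) (hR : IsRegularized k a ρ E S e s) : IsIntegrated P 1 x := by
  refine ⟨ε, e, ⟨fun t => (hx.measurable t).sub (hx.measurable _),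
    fun t => (hx.integrable t).sub (hx.integrable _), hε, hR.coeff_zero,
    ⟨ρ, hR.one_lt, fun z hz => hR.discSummable _ (norm_nonneg z) hz⟩, fun t => ?_⟩, ?_⟩
  · filter_upwards [hx.hasSum_diff hR] with ω h
    simp only [Function.iterate_one, diff]
    rw [hx.integral_diff hε hR, sub_zero]
    exact h t
  · rw [hR.tsum_coeff]
    intro h0
    have h1 := hR.range_one
    obtain ⟨v, hv0, hv⟩ := hA.finiteType.exists_ker
    rw [← arCoeff_zero_eq] at hv
    obtain ⟨w, hw⟩ : v ∈ (E 1).range := h1 ▸ hv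
    rw [h0] at hw
    exact hv0 hw.symm

/-- The increments of a filtered noise `∑ s n (ε (t - n))`, up to those of the common trends, are
the increments of the solution. -/
theorem IsARSolution.diff_filter_eq (hε : IsWhiteNoise P ε) (hx : IsARSolution P k a ε x)
    (hR : IsRegularized k a ρ E S e s) {y : ℤ → Ω → H}
    (hy : ∀ t : ℤ, ∀ᵐ ω ∂P, HasSum (fun n : ℕ => s n (ε (t - n) ω)) (y t ω)) :
    ∀ᵐ ω ∂P, ∀ t, x t ω - x (t - 1) ω = y t ω - y (t - 1) ω + E 1 (ε t ω) := by
  obtain ⟨r, hr1, hr⟩ := exists_between hR.one_lt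
  have hr0 : 0 ≤ r := by linarith
  filter_upwards [hx.hasSum_diff hR, ae_all_iff.2 hy, hx.noise_temperedMean.ae_norm_le
    (fun t => (hε.memLp t).integrable one_le_two) hr1] with ω h1 h2 h3 t
  obtain ⟨M, hM⟩ := h3 t
  have h4 := (hasSum_filter_comp_iff hr0 (discSummable_arSeq 1 _ ρ r hr0 hr)
    (hR.discSummable' r hr0 hr) (w := fun t => ε t ω) (v := fun t => y t ω) hM
    (fun n => h2 _)).2 (hasSum_arSeq_diff (fun t => y t ω) t)
  rw [hR.conv_diff] at h4
  have h5 : HasSum (fun n : ℕ => if n = 0 then E 1 (ε t ω) else 0) (E 1 (ε t ω)) :=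
    hasSum_ite_eq 0 _
  refine (h1 t).unique ((h4.add h5).congr_fun fun n => ?_)
  by_cases hn : n = 0
  · simp [hn]
  · simp [hn]

theorem IsARSolution.hasCommonTrends [BorelSpace H] [SecondCountableTopology H]
    (hε : IsWhiteNoise P ε)
    (hx : IsARSolution P k a ε x) (hR : IsRegularized k a ρ E S e s) :
    HasCommonTrendsOne P k a (E 1) ε x := by
  obtain ⟨y, hym, hyi, hy0, hy⟩ := hx.noise_temperedMean.exists_filter
    (fun t => (hε.memLp t).integrable one_le_two) hε.mean_zero hR.one_lt hR.discSummable'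
  refine ⟨s, y, fun ω => x 0 ω - y 0 ω, ⟨ρ, hR.one_lt,
    fun z hz => hR.discSummable' _ (norm_nonneg z) hz, fun z hz hz1 => ⟨hR.isUnit z hz hz1, ?_⟩⟩,
    hym, hy, (hx.measurable 0).sub (hym 0), (hx.integrable 0).sub (hyi 0),
    ae_of_all _ fun _ => rfl, fun t => ?_, fun t => ?_⟩
  · rw [← hR.eq_inverse_sub z hz1]
    exact hR.hasSum' z hz
  · filter_upwards [hx.diff_filter_eq hε hR hy] with ω h
    refine eq_of_forall_sub_eq (f := fun t => x t ω)
      (g := fun t => E 1 (cumul ε t ω) + y t ω + (x 0 ω - y 0 ω)) ?_ (fun t => ?_) t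
    · simp only [cumul_zero, map_zero]
      abel
    · simp only [h, ← cumul_sub_cumul ε t ω, map_sub]
      abel
  · rw [hx.integral_eq hε hR, integral_sub (hx.integrable 0) (hyi 0), hy0, sub_zero]

end CommonTrends

/-! ### Integration orders of the characteristics and the cointegrating space. -/

section Characteristics

theorem IsARSolution.measurable_characteristic {Ω : Type*} [MeasurableSpace Ω] {P : Measure Ω}
    {H : Type*} [NormedAddCommGroup H] [InnerProductSpace ℂ H] [MeasurableSpace H] [BorelSpace H]
    {k : ℕ} {a : ℕ → H →L[ℂ] H} {ε x : ℤ → Ω → H} (hx : IsARSolution P k a ε x)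
    (v : H) (t : ℤ) :
    Measurable (characteristic v x t) :=
  (innerSL ℂ v).continuous.measurable.comp (hx.measurable t)

variable {Ω : Type*} [MeasurableSpace Ω] {P : Measure Ω} [IsProbabilityMeasure P]
variable {H : Type*} [NormedAddCommGroup H] [InnerProductSpace ℂ H] [CompleteSpace H]
  [MeasurableSpace H] [BorelSpace H] {k : ℕ} {a : ℕ → H →L[ℂ] H} {ε x : ℤ → Ω → H}
  {ρ : ℝ} {E S : ℂ → H →L[ℂ] H} {e s : ℕ → H →L[ℂ] H}

theorem IsARSolution.isIntegratedZero_characteristic (hε : IsWhiteNoise P ε)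
    (hnd : ∀ v : H, v ≠ 0 → crossCov P (ε 0) (ε 0) v v ≠ 0)
    (hx : IsARSolution P k a ε x) (hR : IsRegularized k a ρ E S e s) {v : H}
    (hv : v ∈ tauZero k a) (hv0 : v ≠ 0) : IsIntegratedZero P (characteristic v x) := by
  have hs : ∀ z : ℂ, ‖z‖ < ρ → _ := fun z hz => hR.hasSum_inner' v hz
  refine isIntegratedZero_of_filter hε hnd hx.noise_temperedMean hR.one_lt hs
    (fun z hz => hR.inner_comp_ne_zero' hv0 hv (hz.trans_lt hR.one_lt))
    (hx.measurable_characteristic v) fun t => ?_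
  filter_upwards [hx.hasSum_filter hR.one_lt (discSummable_of_hasSum hs)] with ω h
  refine h t _ ?_
  rw [hR.conv_inner hv]
  refine (hasSum_ite_eq (0 : ℕ) ⟪v, x t ω⟫_ℂ).congr_fun fun n => ?_
  by_cases hn : n = 0 <;> simp [hn]

theorem IsARSolution.isIntegrated_one_characteristic (hε : IsWhiteNoise P ε)
    (hnd : ∀ v : H, v ≠ 0 → crossCov P (ε 0) (ε 0) v v ≠ 0)
    (hx : IsARSolution P k a ε x) (hR : IsRegularized k a ρ E S e s) {v : H}
    (hv : v ∈ (arCoeff k a 0).ker) (hv0 : v ≠ 0) : IsIntegrated P 1 (characteristic v x) := by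
  refine isIntegratedZero_of_filter hε hnd hx.noise_temperedMean hR.one_lt
    (fun z hz => hR.hasSum_inner v hz)
    (fun z hz => hR.inner_comp_ne_zero hv0 hv (hz.trans_lt hR.one_lt))
    (fun t => (hx.measurable_characteristic v t).sub (hx.measurable_characteristic v _))
    fun t => ?_
  filter_upwards [hx.hasSum_diff hR] with ω h
  have h1 := (h t).mapL (innerSL ℂ v)
  rwa [map_sub] at h1

/-- Were `v` not orthogonal to `Im (E 1)`, the trend `⟨v, E 1 s_t⟩` would be unbounded in L², yet
its increments are those of `⟨v, x_t - y_t⟩`, which is bounded after centering. -/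
theorem IsARSolution.mem_tauZero_of_isIntegratedZero (hε : IsWhiteNoise P ε)
    (hnd : ∀ v : H, v ≠ 0 → crossCov P (ε 0) (ε 0) v v ≠ 0)
    (hx : IsARSolution P k a ε x) (hR : IsRegularized k a ρ E S e s) {v : H}
    (hI : IsIntegratedZero P (characteristic v x)) : v ∈ tauZero k a := by
  by_contra hv
  have hφ : innerSL ℂ v ∘L E 1 ≠ 0 := fun h0 => by
    refine hv ((Submodule.mem_orthogonal' _ _).2 fun w hw => ?_)
    obtain ⟨u, rfl⟩ : w ∈ (E 1).range := hR.range_one ▸ hw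
    exact congrArg (fun f => f u) h0
  obtain ⟨η, B, hB, -⟩ := hI
  have hη := hB.whiteNoise
  have hs1 : Summable fun n => ‖innerSL ℂ v ∘L s n‖ :=
    (discSummable_of_hasSum fun z hz => hR.hasSum_inner' v hz).summable_norm hR.one_lt
  obtain ⟨y, -, -, -, hy⟩ := hx.noise_temperedMean.exists_filter
    (fun t => (hε.memLp t).integrable one_le_two) hε.mean_zero hR.one_lt hR.discSummable'
  have hX : ∀ t, (fun ω => ⟪v, x t ω⟫_ℂ - ⟪v, ∫ ω', x 0 ω' ∂P⟫_ℂ) =ᵐ[P] hη.filterLp B t := by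
    intro t
    refine hη.ae_eq_filterLp hB.summable_norm ?_
    have h1 : ∫ ω, characteristic v x t ω ∂P = ⟪v, ∫ ω, x 0 ω ∂P⟫_ℂ := by
      rw [← hx.integral_eq hε hR t]
      exact (innerSL ℂ v).integral_comp_comm (hx.integrable t)
    have h2 := hB.eq_filter t
    simp only [h1] at h2
    exact h2
  have hY : ∀ t, (fun ω => ⟪v, y t ω⟫_ℂ) =ᵐ[P] hε.filterLp (fun n => innerSL ℂ v ∘L s n) t := by
    intro t
    refine hε.ae_eq_filterLp hs1 ?_
    filter_upwards [hy t] with ω h using h.mapL (innerSL ℂ v)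
  set W : ℤ → Lp ℂ 2 P :=
    fun t => hη.filterLp B t - hε.filterLp (fun n => innerSL ℂ v ∘L s n) t with hW
  have hWω : ∀ t, (W t : Ω → ℂ) =ᵐ[P] fun ω =>
      ⟪v, x t ω⟫_ℂ - ⟪v, ∫ ω', x 0 ω' ∂P⟫_ℂ - ⟪v, y t ω⟫_ℂ := by
    intro t
    filter_upwards [hX t, hY t, Lp.coeFn_sub (hη.filterLp B t)
      (hε.filterLp (fun n => innerSL ℂ v ∘L s n) t)] with ω h1 h2 h3
    rw [h1, h2]
    exact h3
  refine hε.not_bounded_sum (hε.fn_zero_injective hnd hφ) (w := W)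
    (fun t => (norm_sub_le _ _).trans (add_le_add (hη.norm_filterLp_le hB.summable_norm t)
      (hε.norm_filterLp_le hs1 t))) fun t => Lp.ext ?_
  filter_upwards [hWω t, hWω (t - 1), Lp.coeFn_sub (W t) (W (t - 1)),
    coeFn_funLp (hε.memLp t) (innerSL ℂ v ∘L E 1), hx.diff_filter_eq hε hR hy]
    with ω h1 h2 h3 h4 h5
  refine h4.trans ?_
  rw [h3, Pi.sub_apply, h1, h2, ContinuousLinearMap.comp_apply, innerSL_apply_apply,
    eq_sub_of_add_eq' (h5 t).symm]
  simp only [inner_sub_right]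
  ring

theorem IsARSolution.cointegratingSpace_eq (hε : IsWhiteNoise P ε)
    (hnd : ∀ v : H, v ≠ 0 → crossCov P (ε 0) (ε 0) v v ≠ 0)
    (hx : IsARSolution P k a ε x) (hR : IsRegularized k a ρ E S e s) :
    cointegratingSpace P 1 x = (tauZero k a : Set H) := by
  ext v
  constructor
  · rintro (⟨b, hb, hI⟩ | rfl)
    · obtain rfl := Nat.lt_one_iff.1 hb
      exact hx.mem_tauZero_of_isIntegratedZero hε hnd hR hI
    · exact zero_mem _
  · intro hv
    by_cases hv0 : v = 0
    · exact Or.inr hv0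
    · exact Or.inl ⟨0, zero_lt_one, hx.isIntegratedZero_characteristic hε hnd hR hv hv0⟩

end Characteristics

theorem not_finiteDimensional_orthogonal {H : Type*} [NormedAddCommGroup H] [InnerProductSpace ℂ H]
    (hH : ¬ FiniteDimensional ℂ H) (U : Submodule ℂ H) [FiniteDimensional ℂ U] :
    ¬ FiniteDimensional ℂ Uᗮ := by
  intro h
  refine hH ?_
  have h1 : FiniteDimensional ℂ (U ⊔ Uᗮ : Submodule ℂ H) := inferInstance
  rw [Submodule.sup_orthogonal_of_hasOrthogonalProjection] at h1
  exact Submodule.topEquiv.finiteDimensional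

end HilbertAR

theorem mainTheorem6
    {H : Type*} [NormedAddCommGroup H] [InnerProductSpace ℂ H] [CompleteSpace H]
    [TopologicalSpace.SeparableSpace H] [MeasurableSpace H] [BorelSpace H]
    (hH : ¬ FiniteDimensional ℂ H)
    {Ω : Type*} [MeasurableSpace Ω] (P : Measure Ω) [IsProbabilityMeasure P]
    (k : ℕ) (a : ℕ → H →L[ℂ] H) (hA : IsUnitRootOfFiniteType k a)
    (ε x : ℤ → Ω → H) (hε : IsWhiteNoise P ε)
    (hnd : ∀ v : H, v ≠ 0 → crossCov P (ε 0) (ε 0) v v ≠ 0)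
    (hx : IsARSolution P k a ε x) :
    (IsIntegrated P 1 x ↔ PoleOneCondition k a) ∧
    (IsIntegrated P 1 x →
      (∃ C : ℕ → H →L[ℂ] H,
        IsLaurentExpansionAtOne (arPoly k a) 1 C ∧
        HasCommonTrendsOne P k a (C 0) ε x ∧
        (C 0).range = tauOne k a) ∧
      attractorSpace P 1 x = tauOne k a ∧
      FiniteDimensional ℂ (tauOne k a) ∧
      cointegratingSpace P 1 x = (tauZero k a : Set H) ∧
      ¬ FiniteDimensional ℂ (tauZero k a) ∧
      (∀ v ∈ tauZero k a, v ≠ 0 → IsIntegrated P 0 (characteristic v x)) ∧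
      (∀ v ∈ tauOne k a, v ≠ 0 → IsIntegrated P 1 (characteristic v x)) ∧
      tauOne k a = (tauZero k a)ᗮ ∧
      tauOne k a ≠ ⊥) := by
  have : SecondCountableTopology H := UniformSpace.secondCountable_of_separable H
  refine ⟨⟨fun hI => poleOneCondition_of_injOn hA (sOne_injOn_of_isIntegrated hA hε hnd hx hI),
    fun h => ?_⟩, fun hI => ?_⟩
  · obtain ⟨ρ, E, S, e, s, hR⟩ := exists_isRegularized hA (sOne_injOn_of_poleOneCondition h)
    exact hx.isIntegrated hA hε hR
  have hinj := sOne_injOn_of_isIntegrated hA hε hnd hx hI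
  obtain ⟨ρ, E, S, e, s, hR⟩ := exists_isRegularized hA hinj
  obtain ⟨C, hC, hC0⟩ := hR.isLaurentExpansion
  have h1 := tauOne_eq_of_injOn hinj
  have hco := hx.cointegratingSpace_eq hε hnd hR
  have hfin : FiniteDimensional ℂ (arCoeff k a 0).ker := (isFredholm_arCoeff hA).finite_ker
  refine ⟨⟨C, hC, ?_, ?_⟩, ?_, ?_, hco, not_finiteDimensional_orthogonal hH _,
    fun v hv hv0 => hx.isIntegratedZero_characteristic hε hnd hR hv hv0,
    fun v hv hv0 => hx.isIntegrated_one_characteristic hε hnd hR (h1 ▸ hv) hv0, ?_,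
    (poleOneCondition_of_injOn hA hinj).ne_bot⟩
  · rw [hC0]
    exact hx.hasCommonTrends hε hR
  · rw [hC0, hR.range_one, h1]
  · rw [attractorSpace, hco, Submodule.span_eq, tauZero_orthogonal, h1]
  · rwa [h1]
  · rw [tauZero_orthogonal, h1]
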